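/- Let $K\ge 2$ and $1\le d<D$ be integers, let $L_1,\dots,L_K$ be $d$-flats ($d$-dimensional affine subspaces) in $\mathbb R^D$, and let $w>0$. Write $T(L,w)=\{x\in\mathbb R^D:\operatorname{dist}(x,L)<w\}$ for the tube of radius $w$ around a flat $L$, let $\mu_i$ be Lebesgue measure on $\mathbb R^D$ restricted to $T(L_i,w)$, and let $\mu=\sum_{i=1}^K\mu_i$. For $x\in\mathbb R^D$ and $r>0$ define the continuous Jones number $$\beta_2(x,r)=\frac1r\,\min_{d\text{-flats }L\subseteq\mathbb R^D}\sqrt{\frac{\int_{B(x,r)}\operatorname{dist}(y,L)^2\,d\mu(y)}{\mu(B(x,r))}}.$$ Fix $1\le i^*\le K$ and $x^*\in L_{i^*}$, and let $r_0=\operatorname{dist}\bigl(x^*,\bigcup_{i\ne i^*}T(L_i,w)\bigr)$. If $w<r_0$, then $r\mapsto\beta_2(x^*,r)$ is constant on $(0,w]$ and strictly decreasing on $[w,r_0]$. If moreover $$\frac{w}{r_0}<\begin{cases}\min\left(0.02,\ \sqrt{\dfrac{D+1}{150\sqrt2\,(D-1)K}}\right), & d=1,\\[2ex] \min\left(0.02,\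 \sqrt{\dfrac{D-d+2}{6\cdot 50^{d/2}\,(D-d)K}}\right), & d>1,\end{cases}$$ then there is $r^*$ with $r_0<r^*<1.09\,r_0$ and $\beta_2(x^*,r^*)>\beta_2(x^*,r_0)$. Furthermore, the first local minimum of $\beta_2(x^*,\cdot)$ after the initial interval $(0,w)$ of constancy occurs in $(r_0,1.09\,r_0)$, in the following sense: the infimum of the set of all $r\ge w$ at which $\beta_2(x^*,\cdot)$ has a local minimum lies in $(r_0,1.09\,r_0)$; in particular there is a local minimum in $(r_0,1.09\,r_0)$ and none in $[w,r_0]$. -/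

import Mathlib

open MeasureTheory

noncomputable section

/-- `L` is a `d`-flat: a nonempty affine subspace of dimension `d`. -/
def IsFlat {D : ℕ} (d : ℕ) (L : AffineSubspace ℝ (EuclideanSpace ℝ (Fin D))) : Prop :=
  (L : Set (EuclideanSpace ℝ (Fin D))).Nonempty ∧ Module.finrank ℝ L.direction = d

/-- The open tube `T(L, w)` of radius `w` around `L`. For a flat `L`, `Metric.infDist x L` is the
distance from `x` to its orthogonal projection onto `L`. -/
def tube {D : ℕ} (L : AffineSubspace ℝ (EuclideanSpace ℝ (Fin D))) (w : ℝ) :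
    Set (EuclideanSpace ℝ (Fin D)) :=
  {x | Metric.infDist x (L : Set (EuclideanSpace ℝ (Fin D))) < w}

/-- The sum `μ = ∑ i, μ_i`, where `μ_i` is Lebesgue measure on the tube `T(L_i, w)`. -/
def tubesMeasure {D K : ℕ} (L : Fin K → AffineSubspace ℝ (EuclideanSpace ℝ (Fin D))) (w : ℝ) :
    Measure (EuclideanSpace ℝ (Fin D)) :=
  ∑ i, volume.restrict (tube (L i) w)

/-- The continuous Jones number `β₂(x, r)` of the measure `μ`, for approximation by `d`-flats:
`r⁻¹` times the minimum over all `d`-flats of the root mean squared distance in `B(x, r)`. -/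
def beta2 {D : ℕ} (d : ℕ) (μ : Measure (EuclideanSpace ℝ (Fin D)))
    (x : EuclideanSpace ℝ (Fin D)) (r : ℝ) : ℝ :=
  (1 / r) * ⨅ L : {L : AffineSubspace ℝ (EuclideanSpace ℝ (Fin D)) // IsFlat d L},
    Real.sqrt ((∫ y in Metric.ball x r,
        Metric.infDist y (L.1 : Set (EuclideanSpace ℝ (Fin D))) ^ 2 ∂μ) /
      μ.real (Metric.ball x r))

/-- The distance `r₀(x)` from `x` to the union of the tubes with index different from `i₀`. -/
def distToOtherTubes {D K : ℕ} (L : Fin K → AffineSubspace ℝ (EuclideanSpace ℝ (Fin D))) (w : ℝ)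
    (i₀ : Fin K) (x : EuclideanSpace ℝ (Fin D)) : ℝ :=
  Metric.infDist x (⋃ i ∈ {i : Fin K | i ≠ i₀}, tube (L i) w)

/-- The explicit upper bound imposed on `w / r₀`. -/
def widthBound (d D K : ℕ) : ℝ :=
  if d = 1 then
    min 0.02 (Real.sqrt (((D : ℝ) + 1) / (150 * Real.sqrt 2 * ((D : ℝ) - 1) * (K : ℝ))))
  else
    min 0.02 (Real.sqrt (((D : ℝ) - (d : ℝ) + 2) /
      (6 * (50 : ℝ) ^ ((d : ℝ) / 2) * ((D : ℝ) - (d : ℝ)) * (K : ℝ))))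

end

/-!
As long as the ball `B(x, r)` meets only the tube around the flat through `x`, the Jones number is
computed by that flat itself. The part `S` of the tube in the ball is symmetric under all isometries
preserving the flat, so its covariance form is diagonal with one eigenvalue along the flat and one
across it, and a reflection exchanging a tangential and a normal direction shows that the first is
the larger one (`setIntegral_norm_nor_sq_le_of_slab`). Rescaling the ball to radius `1` turns the
squared Jones number into the mean of the squared distance to the flat over the unit ball in a tube
of radius `w / r`. This is constant for `r ≤ w`, and it strictly decreases for `r ≥ w` since
shrinking the tube discards points farther away than the mean (`Frame.mean_sq_lt_mean_sq`).

At the radius `1.0899 * r₀` the ball contains a product of a tangential and a normal ball around the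
nearest point of a second flat. A flat that passes near both centres must be tilted against the
second flat, since that flat is orthogonal to the segment joining the centres; the tilt, being the
squared Hilbert–Schmidt norm of a product of two projections of equal rank, controls this
quantitatively (`Frame.norm_tan_chart_sq_le`). Either way the error is bounded below by the second
moment of the tangential ball (`IsCentered.le_minError`), and with the upper bound
`IsCentered.mass_le` for the mass the width condition makes the Jones number exceed its value at `r₀`
(`IsCentered.betaSq_lt`).

Since the Jones number is continuous, it has a local minimum between `r₀` and `1.0899 * r₀`, provided
that it still decreases for a while after `r₀`. To see this, rescale a nearly optimal flat along with
the ball from radius `r` to radius `s`. In the central tube this discards a shell, whose volume is of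
order `s - r` and whose mean squared distance to any flat is at least nearly `w ^ 2`, above the
present mean (`Frame.le_setIntegral_shell`). The other tubes lie in half-spaces at distance `r₀`, so
what they gain lies in thin cones and has volume `o(s - r)`
(`IsCentered.exists_volume_piece_sub_le`). Hence the Jones number decreases strictly on some
`[r₀, r₀ + δ]` (`IsCentered.exists_betaSq_lt`).

All computations take place in frames: isometries of `X × Z`, with the `L²` norm, onto the ambient
space, in which a flat is a level set of the `Z`-component.
-/

open Metric Module

set_option linter.unusedSectionVars false

/-! ### Orthonormal frames and second moments of balls -/

/-- A frame splits `E` isometrically as the orthogonal sum of `X` (tangential directions) and `Z`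
(normal directions). -/
abbrev Frame (X Z E : Type*) [NormedAddCommGroup X] [InnerProductSpace ℝ X]
    [NormedAddCommGroup Z] [InnerProductSpace ℝ Z] [NormedAddCommGroup E]
    [InnerProductSpace ℝ E] :=
  WithLp 2 (X × Z) ≃ₗᵢ[ℝ] E

section FrameBasics

variable {X Z E : Type*} [NormedAddCommGroup X] [InnerProductSpace ℝ X]
  [NormedAddCommGroup Z] [InnerProductSpace ℝ Z] [NormedAddCommGroup E] [InnerProductSpace ℝ E]

/-- The normal component of a vector in a frame. -/
noncomputable def Frame.nor (U : Frame X Z E) : E →ₗ[ℝ] Z where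
  toFun v := (U.symm v).snd
  map_add' := by simp
  map_smul' := by simp

/-- The tangential component of a vector in a frame. -/
noncomputable def Frame.tan (U : Frame X Z E) : E →ₗ[ℝ] X where
  toFun v := (U.symm v).fst
  map_add' := by simp
  map_smul' := by simp

/-- The vector with prescribed tangential and normal components. -/
noncomputable def Frame.chart (U : Frame X Z E) (p : X × Z) : E := U (WithLp.toLp 2 p)

variable (U : Frame X Z E)

@[simp] lemma Frame.nor_chart (p : X × Z) : U.nor (U.chart p) = p.2 := by
  simp [Frame.nor, Frame.chart]

@[simp] lemma Frame.tan_chart (p : X × Z) : U.tan (U.chart p) = p.1 := by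
  simp [Frame.tan, Frame.chart]

@[simp] lemma Frame.chart_tan_nor (v : E) : U.chart (U.tan v, U.nor v) = v := by
  have : WithLp.toLp 2 (U.tan v, U.nor v) = U.symm v := rfl
  simp [Frame.chart, this]

lemma Frame.chart_add (p q : X × Z) : U.chart (p + q) = U.chart p + U.chart q := by
  simp [Frame.chart]

lemma Frame.chart_smul (t : ℝ) (p : X × Z) : U.chart (t • p) = t • U.chart p := by
  simp [Frame.chart]

lemma Frame.inner_eq (v v' : E) :
    inner ℝ v v' = inner ℝ (U.tan v) (U.tan v') + inner ℝ (U.nor v) (U.nor v') := by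
  rw [← U.symm.inner_map_map v v', WithLp.prod_inner_apply]
  rfl

lemma Frame.norm_sq_eq (v : E) : ‖v‖ ^ 2 = ‖U.tan v‖ ^ 2 + ‖U.nor v‖ ^ 2 := by
  rw [← real_inner_self_eq_norm_sq, U.inner_eq, real_inner_self_eq_norm_sq,
    real_inner_self_eq_norm_sq]

lemma Frame.norm_chart_sq (p : X × Z) : ‖U.chart p‖ ^ 2 = ‖p.1‖ ^ 2 + ‖p.2‖ ^ 2 := by
  rw [U.norm_sq_eq]; simp

lemma Frame.norm_nor_le (v : E) : ‖U.nor v‖ ≤ ‖v‖ := by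
  have := U.norm_sq_eq v
  exact abs_le_of_sq_le_sq' (by nlinarith [sq_nonneg ‖U.tan v‖]) (norm_nonneg _) |>.2

lemma Frame.norm_tan_le (v : E) : ‖U.tan v‖ ≤ ‖v‖ := by
  have := U.norm_sq_eq v
  exact abs_le_of_sq_le_sq' (by nlinarith [sq_nonneg ‖U.nor v‖]) (norm_nonneg _) |>.2

lemma Frame.continuous_nor : Continuous U.nor :=
  AddMonoidHomClass.continuous_of_bound U.nor 1 fun v => by simpa using U.norm_nor_le v

lemma Frame.continuous_tan : Continuous U.tan :=
  AddMonoidHomClass.continuous_of_bound U.tan 1 fun v => by simpa using U.norm_tan_le v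

lemma Frame.continuous_chart : Continuous U.chart := by
  unfold Frame.chart
  exact U.continuous.comp (WithLp.prod_continuous_toLp 2 X Z)

/-- A frame identifies `X × Z` and `E` as measurable spaces. -/
noncomputable def Frame.measurableEquiv [MeasurableSpace X] [BorelSpace X] [MeasurableSpace Z] [BorelSpace Z]
    [MeasurableSpace E] [BorelSpace E] [SecondCountableTopology X] [SecondCountableTopology Z] :
    X × Z ≃ᵐ E where
  toFun := U.chart
  invFun v := (U.tan v, U.nor v)
  left_inv p := by simp
  right_inv v := by simp
  measurable_toFun := U.continuous_chart.measurable
  measurable_invFun := (U.continuous_tan.prodMk U.continuous_nor).measurable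

end FrameBasics

section FrameMeasure

variable {X Z E : Type*} [NormedAddCommGroup X] [InnerProductSpace ℝ X]
  [NormedAddCommGroup Z] [InnerProductSpace ℝ Z] [NormedAddCommGroup E] [InnerProductSpace ℝ E]
  [MeasurableSpace X] [BorelSpace X] [MeasurableSpace Z] [BorelSpace Z]
  [MeasurableSpace E] [BorelSpace E]
  [FiniteDimensional ℝ X] [FiniteDimensional ℝ Z] [FiniteDimensional ℝ E]
  (U : Frame X Z E)

lemma Frame.measurePreserving_chart : MeasurePreserving U.chart :=
  U.measurePreserving.comp (WithLp.volume_preserving_toLp X Z)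

lemma Frame.measurableEmbedding_chart : MeasurableEmbedding U.chart :=
  U.measurableEquiv.measurableEmbedding

lemma Frame.setIntegral_chart (f : E → ℝ) (s : Set E) :
    ∫ v in s, f v = ∫ p in U.chart ⁻¹' s, f (U.chart p) :=
  (U.measurePreserving_chart.setIntegral_preimage_emb U.measurableEmbedding_chart f s).symm

lemma Frame.volume_chart (s : Set E) :
    volume s = volume (U.chart ⁻¹' s) :=
  (U.measurePreserving_chart.measure_preimage_emb U.measurableEmbedding_chart s).symm

lemma Frame.volume_real_chart (s : Set E) :
    volume.real s = volume.real (U.chart ⁻¹' s) := by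
  rw [Measure.real, U.volume_chart, Measure.real]

end FrameMeasure

section Moments

variable {Z : Type*} [NormedAddCommGroup Z] [InnerProductSpace ℝ Z]
  [MeasurableSpace Z] [BorelSpace Z] [FiniteDimensional ℝ Z]

/-- Continuous functions are integrable on bounded sets of a finite-dimensional space. -/
lemma integrableOn_of_isBounded {f : Z → ℝ} (hf : Continuous f) {s : Set Z}
    (hs : Bornology.IsBounded s) : IntegrableOn f s :=
  (hf.continuousOn.integrableOn_compact hs.isCompact_closure).mono_set subset_closure

lemma volume_real_ball [Nontrivial Z] {R : ℝ} (hR : 0 ≤ R) :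
    volume.real (ball (0 : Z) R) = R ^ finrank ℝ Z * volume.real (ball (0 : Z) 1) := by
  rw [Measure.real, Measure.addHaar_ball _ _ hR, ENNReal.toReal_mul,
    ENNReal.toReal_ofReal (by positivity), Measure.real]

lemma integral_norm_sq_ball [Nontrivial Z] {R : ℝ} (hR : 0 ≤ R) :
    ∫ z in ball (0 : Z) R, ‖z‖ ^ 2 =
      (finrank ℝ Z : ℝ) / (finrank ℝ Z + 2) * R ^ 2 * volume.real (ball (0 : Z) R) := by
  have h1 : ∫ z in ball (0 : Z) R, ‖z‖ ^ 2 =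
      ∫ z : Z, (fun t : ℝ => (Set.Iio R).indicator (fun t => t ^ 2) t) ‖z‖ := by
    rw [← integral_indicator measurableSet_ball]
    congr 1
    ext z
    simp [Set.indicator]
  have hn : 1 ≤ finrank ℝ Z := finrank_pos
  rw [h1, integral_fun_norm_addHaar, volume_real_ball hR]
  have h2 : ∫ y in Set.Ioi (0 : ℝ), y ^ (finrank ℝ Z - 1) •
      (Set.Iio R).indicator (fun t => t ^ 2) y = ∫ y in (0 : ℝ)..R, y ^ (finrank ℝ Z + 1) := by
    rw [intervalIntegral.integral_of_le hR, integral_Ioc_eq_integral_Ioo,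
      ← integral_indicator measurableSet_Ioi, ← integral_indicator measurableSet_Ioo]
    congr 1
    ext y
    simp only [Set.indicator, Set.mem_Ioi, Set.mem_Iio, Set.mem_Ioo, smul_eq_mul]
    by_cases h : 0 < y <;> by_cases h' : y < R <;> simp [h, h']
    rw [← pow_add]
    congr 1
    omega
  rw [h2, integral_pow]
  simp only [nsmul_eq_mul, smul_eq_mul]
  push_cast
  have : (finrank ℝ Z : ℝ) + 1 + 1 ≠ 0 := by positivity
  have : (finrank ℝ Z : ℝ) + 2 ≠ 0 := by positivity
  rw [zero_pow (by omega), sub_zero]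
  field_simp
  ring

lemma exists_isometry_of_norm_eq {u v : Z} (h : ‖u‖ = ‖v‖) :
    ∃ R : Z ≃ₗᵢ[ℝ] Z, R u = v :=
  ⟨(ℝ ∙ (u - v))ᗮ.reflection, Submodule.reflection_sub h⟩

/-- A function homogeneous of degree two that depends only on the norm is a multiple of the
squared norm; the multiple is found by summing over an orthonormal basis. -/
lemma eq_mul_norm_sq_of_homogeneous [Nontrivial Z] {q : Z → ℝ} {I : ℝ}
    (hq : ∀ t : ℝ, ∀ u, q (t • u) = t ^ 2 * q u) (hr : ∀ u v : Z, ‖u‖ = ‖v‖ → q u = q v)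
    (hI : ∑ j, q (stdOrthonormalBasis ℝ Z j) = I) (u : Z) :
    q u = ‖u‖ ^ 2 * (I / finrank ℝ Z) := by
  have hn : 1 ≤ finrank ℝ Z := finrank_pos
  set b := stdOrthonormalBasis ℝ Z
  have h0 : ∀ j, q (b j) = q (b ⟨0, hn⟩) := fun j => hr _ _ (by simp)
  have h1 : I = finrank ℝ Z * q (b ⟨0, hn⟩) := by
    rw [← hI, Finset.sum_congr rfl fun j _ => h0 j]; simp
  have h2 : q u = q (‖u‖ • b ⟨0, hn⟩) := hr _ _ (by simp [norm_smul])
  have : (finrank ℝ Z : ℝ) ≠ 0 := by positivity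
  rw [h2, hq, h1]
  field_simp

lemma integral_inner_sq_ball [Nontrivial Z] {R : ℝ} (hR : 0 ≤ R) (u : Z) :
    ∫ z in ball (0 : Z) R, inner ℝ u z ^ 2 =
      ‖u‖ ^ 2 * (R ^ 2 / (finrank ℝ Z + 2)) * volume.real (ball (0 : Z) R) := by
  have hn : 1 ≤ finrank ℝ Z := finrank_pos
  have := eq_mul_norm_sq_of_homogeneous (Z := Z)
    (q := fun u => ∫ z in ball (0 : Z) R, inner ℝ u z ^ 2)
    (I := ∫ z in ball (0 : Z) R, ‖z‖ ^ 2) ?_ ?_ ?_ u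
  · rw [this, integral_norm_sq_ball hR]
    field_simp
  · intro t u
    simp only [inner_smul_left, mul_pow]
    rw [integral_const_mul]; simp
  · intro u v h
    obtain ⟨T, hT⟩ := exists_isometry_of_norm_eq h
    have h1 := T.measurePreserving.setIntegral_preimage_emb
      T.toHomeomorph.measurableEmbedding (fun z => inner ℝ v z ^ 2) (ball 0 R)
    have h2 : T ⁻¹' ball 0 R = ball 0 R := by ext z; simp
    rw [h2] at h1
    rw [← h1]
    simp [← hT]
  · rw [← integral_finsetSum]
    · congr 1
      ext z
      rw [← (stdOrthonormalBasis ℝ Z).sum_sq_norm_inner_right z]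
      simp
    · intro j _
      exact integrableOn_of_isBounded (by fun_prop) isBounded_ball

end Moments

/-! ### Flats as level sets of frames -/

section Flats

variable {D d k : ℕ}

/-- A subspace of dimension `d` is the tangential space of some frame. -/
lemma exists_frame_ker_nor (hD : D = d + k) (V : Submodule ℝ (EuclideanSpace ℝ (Fin D)))
    (hV : finrank ℝ V = d) :
    ∃ U : Frame (EuclideanSpace ℝ (Fin d)) (EuclideanSpace ℝ (Fin k)) (EuclideanSpace ℝ (Fin D)),
      ∀ v, v ∈ V ↔ U.nor v = 0 := by
  have hV' : finrank ℝ Vᗮ = k := by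
    have := V.finrank_add_finrank_orthogonal
    rw [hV, finrank_euclideanSpace_fin] at this
    omega
  let b₁ := (stdOrthonormalBasis ℝ V).reindex (finCongr hV)
  let b₂ := (stdOrthonormalBasis ℝ Vᗮ).reindex (finCongr hV')
  let b := (b₁.prod b₂).map V.orthogonalDecomposition.symm
  let e := (EuclideanSpace.basisFun (Fin d) ℝ).prod (EuclideanSpace.basisFun (Fin k) ℝ)
  let U : Frame (EuclideanSpace ℝ (Fin d)) (EuclideanSpace ℝ (Fin k))
    (EuclideanSpace ℝ (Fin D)) := e.equiv b (Equiv.refl _)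
  have hb : ∀ i, U.symm (b i) = e i := fun i => by
    rw [LinearIsometryEquiv.symm_apply_eq]; simp [U]
  have hU : ∀ v j, (U.nor v) j = inner ℝ ((b₂ j : Vᗮ) : EuclideanSpace ℝ (Fin D)) v := by
    intro v j
    have h1 : (b (Sum.inr j) : EuclideanSpace ℝ (Fin D)) = b₂ j := by
      simp [b]
    rw [← h1, ← U.symm.inner_map_map, hb, WithLp.prod_inner_apply]
    simp [e, Frame.nor, EuclideanSpace.inner_single_left]
  refine ⟨U, fun v => ⟨fun hv => ?_, fun hv => ?_⟩⟩
  · ext j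
    rw [hU]
    exact Submodule.inner_left_of_mem_orthogonal hv (b₂ j).2
  · rw [← V.orthogonal_orthogonal]
    intro u hu
    rw [show u = ((⟨u, hu⟩ : Vᗮ) : EuclideanSpace ℝ (Fin D)) from rfl,
      ← b₂.sum_repr ⟨u, hu⟩]
    simp only [AddSubmonoidClass.coe_finsetSum, Submodule.coe_smul, sum_inner, inner_smul_left]
    refine Finset.sum_eq_zero fun j _ => ?_
    rw [← hU, hv]
    simp

/-- The distance to a flat whose direction is the tangential space of a frame. -/
lemma infDist_eq_norm_nor
    {U : Frame (EuclideanSpace ℝ (Fin d)) (EuclideanSpace ℝ (Fin k)) (EuclideanSpace ℝ (Fin D))}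
    {L : AffineSubspace ℝ (EuclideanSpace ℝ (Fin D))}
    (hU : ∀ v, v ∈ L.direction ↔ U.nor v = 0) {p : EuclideanSpace ℝ (Fin D)} (hp : p ∈ L)
    (y : EuclideanSpace ℝ (Fin D)) :
    infDist y L = ‖U.nor (y - p)‖ := by
  apply le_antisymm
  · have hq : p + U.chart (U.tan (y - p), 0) ∈ L := by
      rw [add_comm]
      exact AffineSubspace.vadd_mem_of_mem_direction ((hU _).2 (by simp)) hp
    refine (infDist_le_dist_of_mem hq).trans_eq ?_
    have : y - (p + U.chart (U.tan (y - p), 0)) = U.chart (0, U.nor (y - p)) := by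
      have h := U.chart_tan_nor (y - p)
      have h2 : (U.tan (y - p), U.nor (y - p)) = (U.tan (y - p), 0) + (0, U.nor (y - p)) := by
        simp
      rw [h2, U.chart_add] at h
      rw [← sub_sub, ← h]
      simp
    rw [dist_eq_norm, this]
    have h3 := U.norm_chart_sq (0, U.nor (y - p))
    simp only [norm_zero, ne_eq, OfNat.ofNat_ne_zero, not_false_eq_true, zero_pow, zero_add] at h3
    exact (sq_eq_sq₀ (norm_nonneg _) (norm_nonneg _)).1 h3
  · refine (le_infDist ⟨p, hp⟩).2 fun q hq => ?_
    have h1 : U.nor (q - p) = 0 := (hU _).1 (AffineSubspace.vsub_mem_direction hq hp)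
    have h2 : y - p = (y - q) + (q - p) := by abel
    rw [h2, map_add, h1, add_zero, dist_eq_norm]
    exact U.norm_nor_le _

/-- Every flat is, relative to a base point, a level set of the normal component of a frame. -/
lemma IsFlat.exists_frame (hD : D = d + k) {L : AffineSubspace ℝ (EuclideanSpace ℝ (Fin D))}
    (hL : IsFlat d L) (x : EuclideanSpace ℝ (Fin D)) :
    ∃ (U : Frame (EuclideanSpace ℝ (Fin d)) (EuclideanSpace ℝ (Fin k))
      (EuclideanSpace ℝ (Fin D))) (c : EuclideanSpace ℝ (Fin k)),
      ∀ v, infDist (x + v) L = ‖U.nor v - c‖ := by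
  obtain ⟨p, hp⟩ := hL.1
  obtain ⟨U, hU⟩ := exists_frame_ker_nor hD L.direction hL.2
  refine ⟨U, U.nor (p - x), fun v => ?_⟩
  rw [infDist_eq_norm_nor hU hp, ← map_sub]
  congr 2
  abel

/-- Every level set of the normal component of a frame is a flat. -/
lemma exists_isFlat_of_frame
    (U : Frame (EuclideanSpace ℝ (Fin d)) (EuclideanSpace ℝ (Fin k)) (EuclideanSpace ℝ (Fin D)))
    (c : EuclideanSpace ℝ (Fin k)) (x : EuclideanSpace ℝ (Fin D)) :
    ∃ L : AffineSubspace ℝ (EuclideanSpace ℝ (Fin D)), IsFlat d L ∧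
      ∀ v, infDist (x + v) L = ‖U.nor v - c‖ := by
  set V := LinearMap.ker U.nor
  let e : EuclideanSpace ℝ (Fin d) ≃ₗ[ℝ] V :=
    { toFun := fun y => ⟨U.chart (y, 0), by simp [V]⟩
      invFun := fun v => U.tan v
      map_add' := fun y y' => by ext1; simp [← U.chart_add]
      map_smul' := fun t y => by ext1; simp [← U.chart_smul]
      left_inv := fun y => by simp
      right_inv := fun v => by
        ext1
        have h := U.chart_tan_nor v
        rw [show U.nor (v : EuclideanSpace ℝ (Fin D)) = 0 from v.2] at h
        exact h }
  refine ⟨AffineSubspace.mk' (x + U.chart (0, c)) V, ⟨AffineSubspace.mk'_nonempty _ _, ?_⟩, ?_⟩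
  · rw [AffineSubspace.direction_mk', ← e.finrank_eq, finrank_euclideanSpace_fin]
  · intro v
    rw [infDist_eq_norm_nor (U := U) (by simp [V]) (AffineSubspace.self_mem_mk' _ _)]
    rw [add_sub_add_left_eq_sub, map_sub]
    simp

end Flats

/-! ### Optimality of the central flat -/

section Symmetry

variable {E : Type*} [NormedAddCommGroup E] [InnerProductSpace ℝ E]
  [MeasurableSpace E] [BorelSpace E] [FiniteDimensional ℝ E]

lemma setIntegral_comp_isometry {R : E ≃ₗᵢ[ℝ] E} {S : Set E} (hS : ∀ v, R v ∈ S ↔ v ∈ S)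
    (f : E → ℝ) : ∫ v in S, f (R v) = ∫ v in S, f v := by
  have h := R.measurePreserving.setIntegral_preimage_emb R.toHomeomorph.measurableEmbedding f S
  rwa [show R ⁻¹' S = S from Set.ext hS] at h

lemma setIntegral_eq_zero_of_antisymm {R : E ≃ₗᵢ[ℝ] E} {S : Set E}
    (hS : ∀ v, R v ∈ S ↔ v ∈ S) {f : E → ℝ} (hf : ∀ v, f (R v) = -f v) :
    ∫ v in S, f v = 0 := by
  have h := setIntegral_comp_isometry hS f
  simp only [hf, integral_neg] at h
  linarith

/-- On a centrally symmetric set, the mean square of `A v - c` splits into that of `A v` and the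
constant `‖c‖ ^ 2`. -/
lemma setIntegral_norm_sub_sq {Z : Type*} [NormedAddCommGroup Z] [InnerProductSpace ℝ Z]
    {S : Set E} (hS : ∀ v, -v ∈ S ↔ v ∈ S) (hb : Bornology.IsBounded S)
    {A : E →ₗ[ℝ] Z} (hA : Continuous A) (c : Z) :
    ∫ v in S, ‖A v - c‖ ^ 2 = (∫ v in S, ‖A v‖ ^ 2) + ‖c‖ ^ 2 * volume.real S := by
  have h1 : ∫ v in S, inner ℝ (A v) c = 0 :=
    setIntegral_eq_zero_of_antisymm (R := LinearIsometryEquiv.neg ℝ) (by simpa using hS) (by simp)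
  have h2 : ∀ v, ‖A v - c‖ ^ 2 = ‖A v‖ ^ 2 - 2 * inner ℝ (A v) c + ‖c‖ ^ 2 :=
    fun v => norm_sub_sq_real _ _
  simp only [h2]
  rw [integral_add, integral_sub, integral_const_mul, h1]
  · simp [mul_comm]
  · exact integrableOn_of_isBounded (by fun_prop) hb
  · exact integrableOn_of_isBounded (by fun_prop) hb
  · exact integrableOn_of_isBounded (by fun_prop) hb
  · exact integrableOn_of_isBounded (by fun_prop) hb

end Symmetry

section Minimality

variable {X Z E : Type*} [NormedAddCommGroup X] [InnerProductSpace ℝ X]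
  [NormedAddCommGroup Z] [InnerProductSpace ℝ Z] [NormedAddCommGroup E] [InnerProductSpace ℝ E]
  [MeasurableSpace X] [BorelSpace X] [MeasurableSpace Z] [BorelSpace Z]
  [MeasurableSpace E] [BorelSpace E]
  [FiniteDimensional ℝ X] [FiniteDimensional ℝ Z] [FiniteDimensional ℝ E]

/-- The isometry of `E` acting by given isometries on the two factors of a frame. -/
noncomputable def Frame.prodMap (U : Frame X Z E) (P : X ≃ₗᵢ[ℝ] X) (Q : Z ≃ₗᵢ[ℝ] Z) :
    E ≃ₗᵢ[ℝ] E where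
  toFun v := U.chart (P (U.tan v), Q (U.nor v))
  invFun v := U.chart (P.symm (U.tan v), Q.symm (U.nor v))
  map_add' v v' := by simp [← U.chart_add]
  map_smul' t v := by simp [← U.chart_smul]
  left_inv v := by simp
  right_inv v := by simp
  norm_map' v := by
    rw [← sq_eq_sq₀ (norm_nonneg _) (norm_nonneg _)]
    exact (U.norm_chart_sq _).trans (by simp [U.norm_sq_eq v])

lemma Frame.prodMap_apply (U : Frame X Z E) (P : X ≃ₗᵢ[ℝ] X) (Q : Z ≃ₗᵢ[ℝ] Z) (v : E) :
    U.prodMap P Q v = U.chart (P (U.tan v), Q (U.nor v)) := rfl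

/-- Membership in `S` depends only on the norms of the two components of a vector. -/
def Frame.IsSymmetric (U : Frame X Z E) (S : Set E) : Prop :=
  ∀ v v', ‖U.tan v‖ = ‖U.tan v'‖ → ‖U.nor v‖ = ‖U.nor v'‖ → v ∈ S → v' ∈ S

lemma Frame.IsSymmetric.prodMap_mem {U : Frame X Z E} {S : Set E} (hS : U.IsSymmetric S)
    (P : X ≃ₗᵢ[ℝ] X) (Q : Z ≃ₗᵢ[ℝ] Z) (v : E) : U.prodMap P Q v ∈ S ↔ v ∈ S :=
  ⟨hS _ _ (by simp [Frame.prodMap_apply]) (by simp [Frame.prodMap_apply]),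
    hS _ _ (by simp [Frame.prodMap_apply]) (by simp [Frame.prodMap_apply])⟩

lemma Frame.IsSymmetric.neg_mem {U : Frame X Z E} {S : Set E} (hS : U.IsSymmetric S) (v : E) :
    -v ∈ S ↔ v ∈ S :=
  ⟨hS _ _ (by simp) (by simp), hS _ _ (by simp) (by simp)⟩

lemma Frame.inner_chart (U : Frame X Z E) (p : X × Z) (v : E) :
    inner ℝ (U.chart p) v = inner ℝ p.1 (U.tan v) + inner ℝ p.2 (U.nor v) := by
  rw [U.inner_eq]; simp

lemma Frame.norm_nor_sq_eq_sum (U : Frame X Z E) (v : E) :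
    ‖U.nor v‖ ^ 2 = ∑ j, inner ℝ (U.chart (0, stdOrthonormalBasis ℝ Z j)) v ^ 2 := by
  rw [← (stdOrthonormalBasis ℝ Z).sum_sq_norm_inner_right (U.nor v)]
  simp [U.inner_chart]

/-- If a symmetric set is at least as spread out in each tangential as in each normal direction,
then the central flat of the frame has the least mean squared distance among all flats. The
covariance form of the set is diagonal in the frame, with one eigenvalue on each factor; the mean
squared distance to a flat is the sum of its values on an orthonormal family of normals, plus a
nonnegative term from the offset. -/
lemma setIntegral_norm_nor_sq_le {U : Frame X Z E} {S : Set E} (hS : U.IsSymmetric S)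
    (hb : Bornology.IsBounded S)
    (hswap : ∀ (e : X) (n : Z), ‖e‖ = 1 → ‖n‖ = 1 →
      ∫ v in S, inner ℝ n (U.nor v) ^ 2 ≤ ∫ v in S, inner ℝ e (U.tan v) ^ 2)
    (U' : Frame X Z E) (c : Z) :
    ∫ v in S, ‖U.nor v‖ ^ 2 ≤ ∫ v in S, ‖U'.nor v - c‖ ^ 2 := by
  have hcn := U.continuous_nor
  have hct := U.continuous_tan
  have hcn' := U'.continuous_nor
  rw [setIntegral_norm_sub_sq hS.neg_mem hb hcn']
  refine le_trans ?_ (le_add_of_nonneg_right (by positivity))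
  -- the quadratic form restricted to normal directions is `B ‖n‖ ^ 2`
  set qn : Z → ℝ := fun n => ∫ v in S, inner ℝ n (U.nor v) ^ 2 with hqn
  have hqn_smul : ∀ (t : ℝ) n, qn (t • n) = t ^ 2 * qn n := by
    intro t n
    simp only [hqn, inner_smul_left, mul_pow]
    rw [integral_const_mul]; simp
  have hqn_rot : ∀ n n' : Z, ‖n‖ = ‖n'‖ → qn n = qn n' := by
    intro n n' h
    obtain ⟨T, hT⟩ := exists_isometry_of_norm_eq h
    have h1 := setIntegral_comp_isometry
      (hS.prodMap_mem (LinearIsometryEquiv.refl ℝ X) T) (fun v => inner ℝ n' (U.nor v) ^ 2)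
    rw [hqn]
    simp only
    rw [← h1]
    simp [Frame.prodMap_apply, ← hT]
  rcases subsingleton_or_nontrivial Z with hZ | hZ
  · simp [Subsingleton.elim _ (0 : Z)]
  set B : ℝ := (∑ j, qn (stdOrthonormalBasis ℝ Z j)) / finrank ℝ Z
  have hB : ∀ n, qn n = ‖n‖ ^ 2 * B := eq_mul_norm_sq_of_homogeneous hqn_smul hqn_rot rfl
  have hqe : ∀ e : X, ‖e‖ ^ 2 * B ≤ ∫ v in S, inner ℝ e (U.tan v) ^ 2 := by
    intro e
    rcases eq_or_ne e 0 with rfl | he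
    · simp
    obtain ⟨n, hn⟩ := exists_norm_eq Z (zero_le_one (α := ℝ))
    have he' : ‖e‖ ≠ 0 := by simpa using he
    have h1 := hswap (‖e‖⁻¹ • e) n (by simp [norm_smul, he']) hn
    have h2 : qn n = B := by rw [hB, hn]; ring
    change qn n ≤ _ at h1
    rw [h2] at h1
    simp only [inner_smul_left, mul_pow] at h1
    rw [integral_const_mul] at h1
    simp only [conj_trivial] at h1
    have h3 : 0 < ‖e‖ ^ 2 := by positivity
    rw [inv_pow, inv_mul_eq_div, le_div_iff₀ h3] at h1
    linarith
  have hQ : ∀ u : E, ‖u‖ ^ 2 * B ≤ ∫ v in S, inner ℝ u v ^ 2 := by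
    intro u
    have hcross : ∫ v in S, inner ℝ (U.tan u) (U.tan v) * inner ℝ (U.nor u) (U.nor v) = 0 :=
      setIntegral_eq_zero_of_antisymm
        (hS.prodMap_mem (LinearIsometryEquiv.neg ℝ) (LinearIsometryEquiv.refl ℝ Z))
        (by simp [Frame.prodMap_apply])
    have hexp : ∀ v, inner ℝ u v ^ 2 = inner ℝ (U.tan u) (U.tan v) ^ 2 +
        2 * (inner ℝ (U.tan u) (U.tan v) * inner ℝ (U.nor u) (U.nor v)) +
        inner ℝ (U.nor u) (U.nor v) ^ 2 := by
      intro v; rw [U.inner_eq u v]; ring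
    simp only [hexp]
    rw [integral_add, integral_add, integral_const_mul, hcross, U.norm_sq_eq u]
    · have h1 := hqe (U.tan u)
      have h2 := hB (U.nor u)
      simp only [hqn] at h2
      rw [h2]
      linarith
    all_goals exact integrableOn_of_isBounded (by fun_prop) hb
  have hsum : ∀ U₁ : Frame X Z E, ∫ v in S, ‖U₁.nor v‖ ^ 2 =
      ∑ j, ∫ v in S, inner ℝ (U₁.chart (0, stdOrthonormalBasis ℝ Z j)) v ^ 2 := by
    intro U₁
    simp only [U₁.norm_nor_sq_eq_sum]
    rw [integral_finsetSum]
    intro j _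
    exact integrableOn_of_isBounded (by fun_prop) hb
  rw [hsum U, hsum U']
  refine Finset.sum_le_sum fun j _ => ?_
  have h1 : ∫ v in S, inner ℝ (U.chart (0, stdOrthonormalBasis ℝ Z j)) v ^ 2 = B := by
    have := hB (stdOrthonormalBasis ℝ Z j)
    simpa [hqn, U.inner_chart] using this
  have h2 : ‖U'.chart (0, stdOrthonormalBasis ℝ Z j)‖ ^ 2 = 1 := by
    simp [U'.norm_chart_sq]
  have h3 := hQ (U'.chart (0, stdOrthonormalBasis ℝ Z j))
  rw [h2, one_mul] at h3
  rwa [h1]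

/-- The tube of radius `w` around the flat `{v | U.nor v = c}`. -/
def Frame.slab (U : Frame X Z E) (c : Z) (w : ℝ) : Set E := {v | ‖U.nor v - c‖ < w}

lemma Frame.isOpen_slab (U : Frame X Z E) (c : Z) (w : ℝ) : IsOpen (U.slab c w) :=
  isOpen_lt (U.continuous_nor.sub continuous_const).norm continuous_const

lemma Frame.isSymmetric_ball_inter_slab (U : Frame X Z E) (r w : ℝ) :
    U.IsSymmetric (ball 0 r ∩ U.slab 0 w) := by
  intro v v' h1 h2
  have : ‖v‖ = ‖v'‖ := by
    rw [← sq_eq_sq₀ (norm_nonneg _) (norm_nonneg _), U.norm_sq_eq, U.norm_sq_eq v', h1, h2]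
  simp [Frame.slab, this, h2]

/-- The central flat of a tube is optimal in every ball centred on it. Reflecting in the hyperplane
that exchanges a unit tangential `e` and a unit normal `n` exchanges the corresponding second
moments; on the part of the set that leaves the tube under this reflection the tangential
coordinate is the larger one. -/
lemma setIntegral_norm_nor_sq_le_of_slab (U : Frame X Z E) (r w : ℝ) (U' : Frame X Z E) (c : Z) :
    ∫ v in ball 0 r ∩ U.slab 0 w, ‖U.nor v‖ ^ 2 ≤
      ∫ v in ball 0 r ∩ U.slab 0 w, ‖U'.nor v - c‖ ^ 2 := by
  have hb : Bornology.IsBounded (ball 0 r ∩ U.slab 0 w) :=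
    isBounded_ball.subset Set.inter_subset_left
  refine setIntegral_norm_nor_sq_le (U.isSymmetric_ball_inter_slab r w) hb ?_ U' c
  intro e n he hn
  set S := ball 0 r ∩ U.slab 0 w with hSdef
  have hSm : MeasurableSet S := (isOpen_ball.inter (U.isOpen_slab 0 w)).measurableSet
  have hcn := U.continuous_nor
  have hct := U.continuous_tan
  -- `R` exchanges `e` and `n`; `s` and `t` are the coordinates along `e` and `n`
  set u := U.chart (e, 0) - U.chart (0, n) with hu
  set s : E → ℝ := fun v => inner ℝ e (U.tan v) with hs
  set t : E → ℝ := fun v => inner ℝ n (U.nor v) with ht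
  have hu2 : ‖u‖ ^ 2 = 2 := by
    rw [U.norm_sq_eq]; simp [hu, he, hn]; norm_num
  set R : E ≃ₗᵢ[ℝ] E := (ℝ ∙ u)ᗮ.reflection
  have hRR : ∀ v, R (R v) = v := fun v => Submodule.reflection_reflection _ v
  have hR : ∀ v, R v = v - (s v - t v) • u := by
    intro v
    have h1 : inner ℝ u v = s v - t v := by
      rw [hu, inner_sub_left, U.inner_chart, U.inner_chart]; simp [hs, ht]
    simp only [R]
    rw [Submodule.reflection_orthogonal_apply, Submodule.reflection_singleton_apply]
    simp only [RCLike.ofReal_real_eq_id, id_eq]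
    rw [hu2, h1, neg_sub, two_smul, ← add_smul, add_halves]
  have htan : ∀ v, U.tan (R v) = U.tan v - (s v - t v) • e := by
    intro v; rw [hR]; simp [hu]
  have hnor : ∀ v, U.nor (R v) = U.nor v + (s v - t v) • n := by
    intro v; rw [hR]; simp [hu]
  have hsR : ∀ v, s (R v) = t v := by
    intro v; simp [hs, htan, inner_sub_right, inner_smul_right, he]
  have htR : ∀ v, t (R v) = s v := by
    intro v; simp [ht, hnor, inner_add_right, inner_smul_right, hn]
  have hnorm : ∀ v, ‖U.nor (R v)‖ ^ 2 = ‖U.nor v‖ ^ 2 + (s v ^ 2 - t v ^ 2) := by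
    intro v
    rw [hnor, norm_add_sq_real, inner_smul_right, real_inner_comm, norm_smul, hn, mul_one,
      Real.norm_eq_abs, sq_abs]
    change _ + 2 * ((s v - t v) * t v) + _ = _
    ring
  have hsc : Continuous s := by fun_prop
  have htc : Continuous t := by fun_prop
  set f : E → ℝ := fun v => s v ^ 2 - t v ^ 2 with hf
  have hfc : Continuous f := by fun_prop
  have hRm : MeasurableSet (R ⁻¹' S) := R.continuous.measurable hSm
  suffices h : 0 ≤ ∫ v in S, f v by
    rw [integral_sub] at h
    · linarith
    · exact integrableOn_of_isBounded (by fun_prop) hb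
    · exact integrableOn_of_isBounded (by fun_prop) hb
  rw [← integral_inter_add_sdiff hRm (integrableOn_of_isBounded hfc hb)]
  -- the reflection exchanges `s` and `t`, so the part of `S` that it preserves cancels
  have h1 : ∫ v in S ∩ R ⁻¹' S, f v = 0 :=
    setIntegral_eq_zero_of_antisymm (R := R) (by
      intro v
      simp only [Set.mem_inter_iff, Set.mem_preimage, hRR]
      tauto) (by intro v; simp [hf, hsR, htR])
  rw [h1, zero_add]
  refine setIntegral_nonneg (hSm.diff hRm) fun v hv => ?_
  -- if `s ^ 2 < t ^ 2`, the reflection brings `v` closer to the flat, hence keeps it in the tube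
  by_contra! hneg
  refine hv.2 ⟨?_, ?_⟩
  · simpa using hv.1.1
  · have h2 : ‖U.nor v‖ < w := by simpa [Frame.slab] using hv.1.2
    have h3 : ‖U.nor (R v)‖ < w := by
      refine lt_of_le_of_lt ?_ h2
      refine le_of_sq_le_sq (le_of_eq_of_le (hnorm v) ?_) (norm_nonneg _)
      simp only [hf] at hneg
      linarith
    simpa [Frame.slab] using h3

end Minimality

/-! ### Slices, shells and scaling of a ball in a tube -/

section Slices

variable {X Z E : Type*} [NormedAddCommGroup X] [InnerProductSpace ℝ X]
  [NormedAddCommGroup Z] [InnerProductSpace ℝ Z] [NormedAddCommGroup E] [InnerProductSpace ℝ E]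
  [MeasurableSpace X] [BorelSpace X] [MeasurableSpace Z] [BorelSpace Z]
  [MeasurableSpace E] [BorelSpace E]
  [FiniteDimensional ℝ X] [FiniteDimensional ℝ Z] [FiniteDimensional ℝ E]

lemma Frame.integrableOn_chart (U : Frame X Z E) {f : E → ℝ} (hf : Continuous f) {s : Set E}
    (hs : Bornology.IsBounded s) :
    IntegrableOn (fun p => f (U.chart p)) (U.chart ⁻¹' s) :=
  (U.measurePreserving_chart.integrableOn_comp_preimage U.measurableEmbedding_chart).2
    (integrableOn_of_isBounded hf hs)

/-- A set integral is nonnegative if all its integrals over normal slices are. -/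
lemma Frame.setIntegral_nonneg_of_slice_nor (U : Frame X Z E) {f : E → ℝ} (hf : Continuous f)
    {s : Set E} (hs : Bornology.IsBounded s) (hsm : MeasurableSet s)
    (h : ∀ y, 0 ≤ ∫ z in {z | U.chart (y, z) ∈ s}, f (U.chart (y, z))) :
    0 ≤ ∫ v in s, f v := by
  have hm : MeasurableSet (U.chart ⁻¹' s) := U.continuous_chart.measurable hsm
  rw [U.setIntegral_chart, ← integral_indicator hm, Measure.volume_eq_prod,
    integral_prod _ (by
      rw [← Measure.volume_eq_prod, integrable_indicator_iff hm]
      exact U.integrableOn_chart hf hs)]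
  refine integral_nonneg fun y => ?_
  refine (h y).trans_eq ?_
  rw [← integral_indicator]
  · rfl
  · exact (U.continuous_chart.comp (Continuous.prodMk_right y)).measurable hsm

/-- A set integral is nonnegative if all its integrals over tangential slices are. -/
lemma Frame.setIntegral_nonneg_of_slice_tan (U : Frame X Z E) {f : E → ℝ} (hf : Continuous f)
    {s : Set E} (hs : Bornology.IsBounded s) (hsm : MeasurableSet s)
    (h : ∀ z, 0 ≤ ∫ y in {y | U.chart (y, z) ∈ s}, f (U.chart (y, z))) :
    0 ≤ ∫ v in s, f v := by
  have hm : MeasurableSet (U.chart ⁻¹' s) := U.continuous_chart.measurable hsm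
  rw [U.setIntegral_chart, ← integral_indicator hm, Measure.volume_eq_prod,
    integral_prod_symm _ (by
      rw [← Measure.volume_eq_prod, integrable_indicator_iff hm]
      exact U.integrableOn_chart hf hs)]
  refine integral_nonneg fun z => ?_
  refine (h z).trans_eq ?_
  rw [← integral_indicator]
  · rfl
  · exact (U.continuous_chart.comp (Continuous.prodMk_left z)).measurable hsm

lemma Frame.chart_mem_ball (U : Frame X Z E) {r : ℝ} (hr : 0 < r) (y : X) (z : Z) :
    U.chart (y, z) ∈ ball (0 : E) r ↔ ‖y‖ ^ 2 + ‖z‖ ^ 2 < r ^ 2 := by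
  rw [mem_ball_zero_iff, ← sq_lt_sq₀ (norm_nonneg _) hr.le, U.norm_chart_sq]

@[simp] lemma Frame.chart_mem_slab (U : Frame X Z E) (c : Z) (w : ℝ) (y : X) (z : Z) :
    U.chart (y, z) ∈ U.slab c w ↔ ‖z - c‖ < w := by
  simp [Frame.slab]

/-- Each normal slice of a ball in a tube is a ball of radius at most `w`, whose mean squared
radius is `k / (k + 2)` times the square of its radius. -/
lemma Frame.setIntegral_norm_nor_sq_slab_le [Nontrivial Z] (U : Frame X Z E) {r w : ℝ}
    (hr : 0 < r) (hw : 0 < w) :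
    ∫ v in ball 0 r ∩ U.slab 0 w, ‖U.nor v‖ ^ 2 ≤
      (finrank ℝ Z : ℝ) / (finrank ℝ Z + 2) * w ^ 2 *
        volume.real (ball 0 r ∩ U.slab 0 w) := by
  have hb : Bornology.IsBounded (ball 0 r ∩ U.slab 0 w) :=
    isBounded_ball.subset Set.inter_subset_left
  have hcn := U.continuous_nor
  set κ : ℝ := (finrank ℝ Z : ℝ) / (finrank ℝ Z + 2) * w ^ 2 with hκ
  suffices h : 0 ≤ ∫ v in ball 0 r ∩ U.slab 0 w, (κ - ‖U.nor v‖ ^ 2) by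
    rw [integral_sub (integrableOn_of_isBounded (by fun_prop) hb)
      (integrableOn_of_isBounded (by fun_prop) hb)] at h
    simp only [integral_const, measureReal_restrict_apply_univ, smul_eq_mul] at h
    linarith
  refine U.setIntegral_nonneg_of_slice_nor (by fun_prop) hb
    (isOpen_ball.inter (U.isOpen_slab 0 w)).measurableSet fun y => ?_
  set R := min w √(r ^ 2 - ‖y‖ ^ 2) with hRdef
  have hR : 0 ≤ R := le_min hw.le (Real.sqrt_nonneg _)
  have hset : {z | U.chart (y, z) ∈ ball 0 r ∩ U.slab 0 w} = ball (0 : Z) R := by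
    ext z
    simp only [Set.mem_inter_iff, U.chart_mem_ball hr, Frame.chart_mem_slab, sub_zero,
      Set.mem_ofPred_eq, mem_ball_zero_iff, hRdef, lt_min_iff, Real.lt_sqrt (norm_nonneg z)]
    rw [and_comm, lt_sub_iff_add_lt']
  rw [hset]
  simp only [Frame.nor_chart]
  rw [integral_sub (integrableOn_of_isBounded (by fun_prop) isBounded_ball)
      (integrableOn_of_isBounded (by fun_prop) isBounded_ball), integral_norm_sq_ball hR]
  simp only [integral_const, measureReal_restrict_apply_univ, smul_eq_mul]
  have h1 : R ^ 2 ≤ w ^ 2 := by gcongr; exact min_le_left _ _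
  have h2 : (finrank ℝ Z : ℝ) / (finrank ℝ Z + 2) * R ^ 2 ≤ κ := by rw [hκ]; gcongr
  have h3 : 0 ≤ volume.real (ball (0 : Z) R) := measureReal_nonneg
  nlinarith

/-- The shell of a ball in a tube, between two tubes around the same flat. -/
def Frame.shell (U : Frame X Z E) (r w' w : ℝ) : Set E :=
  (ball 0 r ∩ U.slab 0 w) \ U.slab 0 w'

lemma Frame.measurableSet_shell (U : Frame X Z E) (r w' w : ℝ) :
    MeasurableSet (U.shell r w' w) :=
  (isOpen_ball.inter (U.isOpen_slab 0 w)).measurableSet.diff (U.isOpen_slab 0 w').measurableSet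

lemma Frame.isBounded_shell (U : Frame X Z E) (r w' w : ℝ) :
    Bornology.IsBounded (U.shell r w' w) :=
  isBounded_ball.subset (Set.sdiff_subset.trans Set.inter_subset_left)

lemma Frame.isSymmetric_shell (U : Frame X Z E) (r w' w : ℝ) :
    U.IsSymmetric (U.shell r w' w) := by
  intro v v' h1 h2
  have : ‖v‖ = ‖v'‖ := by
    rw [← sq_eq_sq₀ (norm_nonneg _) (norm_nonneg _), U.norm_sq_eq, U.norm_sq_eq v', h1, h2]
  simp [Frame.shell, Frame.slab, this, h2]

/-- For a thin tube the central flat is also optimal for the shells: every tangential slice is a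
ball whose second moment in each direction is at least `w ^ 2`. -/
lemma Frame.le_setIntegral_shell [Nontrivial X] (U : Frame X Z E) {r w' w : ℝ} (hr : 0 < r)
    (hw' : 0 ≤ w') (hwr : (finrank ℝ X + 2) * w ^ 2 ≤ r ^ 2 - w ^ 2) (U' : Frame X Z E) (c : Z) :
    w' ^ 2 * volume.real (U.shell r w' w) ≤ ∫ v in U.shell r w' w, ‖U'.nor v - c‖ ^ 2 := by
  have hb := U.isBounded_shell r w' w
  have hm := U.measurableSet_shell r w' w
  have hcn := U.continuous_nor
  have hct := U.continuous_tan
  refine le_trans ?_ (setIntegral_norm_nor_sq_le (U.isSymmetric_shell r w' w) hb ?_ U' c)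
  · have h := setIntegral_mono_on (μ := volume) (f := fun _ : E => w' ^ 2)
      (g := fun v => ‖U.nor v‖ ^ 2)
      (integrableOn_of_isBounded (by fun_prop) hb)
      (integrableOn_of_isBounded (by fun_prop) hb) hm (fun v hv => by
        have : w' ≤ ‖U.nor v‖ := by simpa [Frame.shell, Frame.slab] using hv.2
        gcongr)
    simp only [integral_const, measureReal_restrict_apply_univ, smul_eq_mul] at h
    linarith
  · intro e n he hn
    suffices h : 0 ≤ ∫ v in U.shell r w' w,
        (inner ℝ e (U.tan v) ^ 2 - inner ℝ n (U.nor v) ^ 2) by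
      rw [integral_sub (integrableOn_of_isBounded (by fun_prop) hb)
        (integrableOn_of_isBounded (by fun_prop) hb)] at h
      linarith
    refine U.setIntegral_nonneg_of_slice_tan (by fun_prop) hb hm fun z => ?_
    by_cases hz : ‖z‖ < w ∧ w' ≤ ‖z‖
    · set R := √(r ^ 2 - ‖z‖ ^ 2) with hRdef
      have hset : {y | U.chart (y, z) ∈ U.shell r w' w} = ball (0 : X) R := by
        ext y
        simp only [Frame.shell, Set.mem_sdiff, Set.mem_inter_iff, U.chart_mem_ball hr,
          Frame.chart_mem_slab, sub_zero, hz.1, and_true, not_lt, hz.2,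
          Set.mem_ofPred_eq, mem_ball_zero_iff, hRdef, Real.lt_sqrt (norm_nonneg y)]
        rw [lt_sub_iff_add_lt]
      rw [hset]
      simp only [Frame.nor_chart, Frame.tan_chart]
      rw [integral_sub (integrableOn_of_isBounded (by fun_prop) isBounded_ball)
        (integrableOn_of_isBounded (by fun_prop) isBounded_ball),
        integral_inner_sq_ball (Real.sqrt_nonneg _)]
      simp only [integral_const, measureReal_restrict_apply_univ, smul_eq_mul, he]
      have hz2 : ‖z‖ ^ 2 ≤ w ^ 2 := by
        have := hz.1.le
        gcongr
      have hR2 : R ^ 2 = r ^ 2 - ‖z‖ ^ 2 := Real.sq_sqrt (by nlinarith)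
      have h1 : w ^ 2 ≤ R ^ 2 / (finrank ℝ X + 2) := by
        rw [le_div_iff₀ (by positivity), hR2]; nlinarith
      have h2 : inner ℝ n z ^ 2 ≤ ‖z‖ ^ 2 := by
        have := abs_real_inner_le_norm n z
        rw [hn, one_mul] at this
        exact sq_le_sq' (by linarith [neg_abs_le (inner ℝ n z)])
          ((le_abs_self _).trans this)
      have h3 : 0 ≤ volume.real (ball (0 : X) R) := measureReal_nonneg
      nlinarith
    · have hset : {y | U.chart (y, z) ∈ U.shell r w' w} = ∅ := by
        ext y
        simp only [Frame.shell, Set.mem_sdiff, Set.mem_inter_iff, Frame.chart_mem_slab, sub_zero,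
          not_lt, Set.mem_ofPred_eq, Set.mem_empty_iff_false, iff_false]
        tauto
      simp [hset]

end Slices

section Scaling

open scoped Pointwise

variable {X Z E : Type*} [NormedAddCommGroup X] [InnerProductSpace ℝ X]
  [NormedAddCommGroup Z] [InnerProductSpace ℝ Z] [NormedAddCommGroup E] [InnerProductSpace ℝ E]
  [MeasurableSpace X] [BorelSpace X] [MeasurableSpace Z] [BorelSpace Z]
  [MeasurableSpace E] [BorelSpace E]
  [FiniteDimensional ℝ X] [FiniteDimensional ℝ Z] [FiniteDimensional ℝ E]

lemma Frame.smul_ball_inter_slab (U : Frame X Z E) {t : ℝ} (ht : 0 < t) (r w : ℝ) :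
    t • (ball (0 : E) r ∩ U.slab 0 w) = ball 0 (t * r) ∩ U.slab 0 (t * w) := by
  ext v
  rw [Set.mem_smul_set_iff_inv_smul_mem₀ ht.ne']
  simp [Frame.slab, norm_smul, abs_of_pos ht, inv_mul_lt_iff₀ ht]

lemma Frame.volume_real_ball_inter_slab_smul (U : Frame X Z E) {t : ℝ} (ht : 0 < t) (r w : ℝ) :
    volume.real (ball (0 : E) (t * r) ∩ U.slab 0 (t * w)) =
      t ^ finrank ℝ E * volume.real (ball (0 : E) r ∩ U.slab 0 w) := by
  rw [← U.smul_ball_inter_slab ht, Measure.real, Measure.addHaar_smul, ENNReal.toReal_mul,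
    ENNReal.toReal_ofReal (by positivity), abs_of_pos (by positivity), Measure.real]

lemma Frame.setIntegral_ball_inter_slab_smul (U : Frame X Z E) {t : ℝ} (ht : 0 < t) (r w : ℝ)
    (U' : Frame X Z E) (c : Z) :
    ∫ v in ball (0 : E) (t * r) ∩ U.slab 0 (t * w), ‖U'.nor v - t • c‖ ^ 2 =
      t ^ (finrank ℝ E + 2) * ∫ v in ball (0 : E) r ∩ U.slab 0 w, ‖U'.nor v - c‖ ^ 2 := by
  have h := Measure.setIntegral_comp_smul_of_pos (volume : Measure E)
    (fun v => ‖U'.nor v - t • c‖ ^ 2) (ball (0 : E) r ∩ U.slab 0 w) ht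
  rw [U.smul_ball_inter_slab ht] at h
  have h2 : ∀ v, ‖U'.nor (t • v) - t • c‖ ^ 2 = t ^ 2 * ‖U'.nor v - c‖ ^ 2 := by
    intro v
    rw [map_smul, ← smul_sub, norm_smul, mul_pow, Real.norm_eq_abs, sq_abs]
  simp only [h2] at h
  rw [integral_const_mul, smul_eq_mul] at h
  have h3 : t ^ finrank ℝ E ≠ 0 := by positivity
  rw [eq_inv_mul_iff_mul_eq₀ h3] at h
  rw [← h, pow_add]
  ring

lemma Frame.volume_real_ball_inter_slab_pos (U : Frame X Z E) {r w : ℝ} (hr : 0 < r)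
    (hw : 0 < w) : 0 < volume.real (ball (0 : E) r ∩ U.slab 0 w) := by
  have hfin : volume (ball (0 : E) r ∩ U.slab 0 w) ≠ ⊤ :=
    (measure_mono Set.inter_subset_left).trans_lt measure_ball_lt_top |>.ne
  refine ENNReal.toReal_pos (IsOpen.measure_pos _ (isOpen_ball.inter (U.isOpen_slab 0 w))
    ⟨0, by simp [hr], by simp [Frame.slab, hw]⟩).ne' hfin

/-- The mean squared distance to the central flat, over the unit ball in a tube, strictly increases
with the radius of the tube: points are added that lie farther away than the mean. -/
lemma Frame.mean_sq_lt_mean_sq [Nontrivial Z] (U : Frame X Z E) {w' w : ℝ} (hw' : 0 < w')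
    (hww : w' < w) (hw : w ≤ 1) :
    (∫ v in ball 0 1 ∩ U.slab 0 w', ‖U.nor v‖ ^ 2) / volume.real (ball (0 : E) 1 ∩ U.slab 0 w') <
    (∫ v in ball 0 1 ∩ U.slab 0 w, ‖U.nor v‖ ^ 2) / volume.real (ball (0 : E) 1 ∩ U.slab 0 w) := by
  have hcn := U.continuous_nor
  set S' := ball (0 : E) 1 ∩ U.slab 0 w' with hS'
  set S := ball (0 : E) 1 ∩ U.slab 0 w with hS
  have hb : Bornology.IsBounded S := isBounded_ball.subset Set.inter_subset_left
  have hm' : MeasurableSet S' := (isOpen_ball.inter (U.isOpen_slab 0 w')).measurableSet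
  have hm : MeasurableSet S := (isOpen_ball.inter (U.isOpen_slab 0 w)).measurableSet
  have hsub : S' ⊆ S := Set.inter_subset_inter_right _ fun v hv => lt_trans hv hww
  have hS'pos : 0 < volume.real S' := U.volume_real_ball_inter_slab_pos one_pos hw'
  have hfin : volume S ≠ ⊤ :=
    (measure_mono Set.inter_subset_left).trans_lt measure_ball_lt_top |>.ne
  have hpos : 0 < volume.real (S \ S') := by
    obtain ⟨z, hz⟩ := exists_norm_eq Z (show (0 : ℝ) ≤ (w' + w) / 2 by linarith)
    have hop : IsOpen {v : E | ‖v‖ < 1 ∧ ‖U.nor v‖ < w ∧ w' < ‖U.nor v‖} :=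
      (isOpen_lt continuous_norm continuous_const).inter
        ((isOpen_lt hcn.norm continuous_const).inter (isOpen_lt continuous_const hcn.norm))
    refine ENNReal.toReal_pos (((hop.measure_pos volume ⟨U.chart (0, z), ?_, ?_, ?_⟩).trans_le
      (measure_mono ?_)).ne') (measure_mono Set.sdiff_subset |>.trans_lt hfin.lt_top).ne
    · rw [← sq_lt_sq₀ (norm_nonneg _) zero_le_one, U.norm_chart_sq, hz]
      simp only [norm_zero]
      nlinarith
    · simp [hz]; linarith
    · simp [hz]; linarith
    · rintro v ⟨h1, h2, h3⟩
      simp only [hS, hS', Frame.slab, Set.mem_sdiff, Set.mem_inter_iff, mem_ball_zero_iff,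
        Set.mem_ofPred_eq, sub_zero]
      exact ⟨⟨h1, h2⟩, fun h => absurd h3 (not_lt.2 h.2.le)⟩
  have hadd : volume.real S = volume.real S' + volume.real (S \ S') := by
    rw [measureReal_sdiff hsub hm']; ring
  have hint : ∫ v in S, ‖U.nor v‖ ^ 2 =
      (∫ v in S', ‖U.nor v‖ ^ 2) + ∫ v in S \ S', ‖U.nor v‖ ^ 2 := by
    rw [setIntegral_sdiff hm' (integrableOn_of_isBounded (by fun_prop) hb) hsub]; ring
  have hshell : w' ^ 2 * volume.real (S \ S') ≤ ∫ v in S \ S', ‖U.nor v‖ ^ 2 := by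
    have h := setIntegral_mono_on (μ := volume) (f := fun _ : E => w' ^ 2)
      (g := fun v => ‖U.nor v‖ ^ 2) (s := S \ S')
      (integrableOn_of_isBounded (by fun_prop) (hb.subset Set.sdiff_subset))
      (integrableOn_of_isBounded (by fun_prop) (hb.subset Set.sdiff_subset)) (hm.diff hm')
      (fun v hv => by
        have : w' ≤ ‖U.nor v‖ := by
          by_contra! h
          exact hv.2 ⟨hv.1.1, by simpa [Frame.slab] using h⟩
        gcongr)
    simp only [integral_const, measureReal_restrict_apply_univ, smul_eq_mul] at h
    linarith
  have hcore := U.setIntegral_norm_nor_sq_slab_le one_pos hw'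
  rw [← hS'] at hcore
  have hk : (finrank ℝ Z : ℝ) / (finrank ℝ Z + 2) < 1 := by
    rw [div_lt_one (by positivity)]; linarith
  have hlt : ∫ v in S', ‖U.nor v‖ ^ 2 < w' ^ 2 * volume.real S' := by
    refine hcore.trans_lt ?_
    have : 0 < w' ^ 2 * volume.real S' := by positivity
    nlinarith
  rw [div_lt_div_iff₀ hS'pos (by linarith), hint, hadd]
  nlinarith

end Scaling

/-! ### Families of tubes and the Jones number -/

section Configuration

variable {ι X Z E : Type*} [Fintype ι] [NormedAddCommGroup X] [InnerProductSpace ℝ X]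
  [NormedAddCommGroup Z] [InnerProductSpace ℝ Z] [NormedAddCommGroup E] [InnerProductSpace ℝ E]
  [MeasurableSpace X] [BorelSpace X] [MeasurableSpace Z] [BorelSpace Z]
  [MeasurableSpace E] [BorelSpace E]
  [FiniteDimensional ℝ X] [FiniteDimensional ℝ Z] [FiniteDimensional ℝ E]

/-- A finite family of tubes of radius `w`, seen from the origin: the `i`-th tube surrounds the flat
`{v | (U i).nor v = c i}`. -/
structure TubeFamily (ι X Z E : Type*) [NormedAddCommGroup X] [InnerProductSpace ℝ X]
    [NormedAddCommGroup Z] [InnerProductSpace ℝ Z] [NormedAddCommGroup E]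
    [InnerProductSpace ℝ E] where
  /-- the frame of the `i`-th flat -/
  U : ι → Frame X Z E
  /-- the normal offset of the `i`-th flat -/
  c : ι → Z
  /-- the common radius of the tubes -/
  w : ℝ

namespace TubeFamily

/-- The part of the `i`-th tube inside the ball of radius `r` around the origin. -/
def piece (T : TubeFamily ι X Z E) (i : ι) (r : ℝ) : Set E :=
  ball 0 r ∩ (T.U i).slab (T.c i) T.w

/-- The total mass of the ball of radius `r`, with multiplicity. -/
noncomputable def mass (T : TubeFamily ι X Z E) (r : ℝ) : ℝ := ∑ i, volume.real (T.piece i r)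

/-- The integral of the squared distance to the flat `{v | V.nor v = a}` over the ball of
radius `r`. -/
noncomputable def sqError (T : TubeFamily ι X Z E) (V : Frame X Z E) (a : Z) (r : ℝ) : ℝ :=
  ∑ i, ∫ v in T.piece i r, ‖V.nor v - a‖ ^ 2

/-- The infimum over all flats of the integrated squared distance. -/
noncomputable def minError (T : TubeFamily ι X Z E) (r : ℝ) : ℝ :=
  ⨅ p : Frame X Z E × Z, T.sqError p.1 p.2 r

lemma isOpen_piece (T : TubeFamily ι X Z E) (i : ι) (r : ℝ) : IsOpen (T.piece i r) :=
  isOpen_ball.inter ((T.U i).isOpen_slab _ _)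

lemma measurableSet_piece (T : TubeFamily ι X Z E) (i : ι) (r : ℝ) :
    MeasurableSet (T.piece i r) := (T.isOpen_piece i r).measurableSet

lemma isBounded_piece (T : TubeFamily ι X Z E) (i : ι) (r : ℝ) :
    Bornology.IsBounded (T.piece i r) := isBounded_ball.subset Set.inter_subset_left

lemma volume_piece_lt_top (T : TubeFamily ι X Z E) (i : ι) (r : ℝ) :
    volume (T.piece i r) < ⊤ := (measure_mono Set.inter_subset_left).trans_lt measure_ball_lt_top

lemma sqError_nonneg (T : TubeFamily ι X Z E) (V : Frame X Z E) (a : Z) (r : ℝ) :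
    0 ≤ T.sqError V a r :=
  Finset.sum_nonneg fun _ _ => integral_nonneg fun _ => by positivity

lemma bddBelow_sqError (T : TubeFamily ι X Z E) (r : ℝ) :
    BddBelow (Set.range fun p : Frame X Z E × Z => T.sqError p.1 p.2 r) :=
  ⟨0, by rintro _ ⟨p, rfl⟩; exact T.sqError_nonneg _ _ _⟩

lemma minError_le (T : TubeFamily ι X Z E) (V : Frame X Z E) (a : Z) (r : ℝ) :
    T.minError r ≤ T.sqError V a r :=
  ciInf_le (T.bddBelow_sqError r) (V, a)

end TubeFamily

end Configuration

section Reduction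

variable {D d k K : ℕ}

/-- The Jones number of a family of tubes around flats, in terms of frames of these flats. -/
lemma beta2_eq_sqrt_minError (hD : D = d + k)
    {L : Fin K → AffineSubspace ℝ (EuclideanSpace ℝ (Fin D))} {x : EuclideanSpace ℝ (Fin D)}
    {T : TubeFamily (Fin K) (EuclideanSpace ℝ (Fin d)) (EuclideanSpace ℝ (Fin k))
      (EuclideanSpace ℝ (Fin D))} [Nonempty (Fin K)]
    (hT : ∀ i v, infDist (x + v) (L i) = ‖(T.U i).nor v - T.c i‖) (r : ℝ) :
    beta2 d (tubesMeasure L T.w) x r = 1 / r * √(T.minError r / T.mass r) := by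
  have htm : ∀ i, MeasurableSet (tube (L i) T.w) := fun i =>
    measurableSet_lt (continuous_infDist_pt _).measurable measurable_const
  have hmp := measurePreserving_add_left (volume : Measure (EuclideanSpace ℝ (Fin D))) x
  have hpre : ∀ i, (x + ·) ⁻¹' (ball x r ∩ tube (L i) T.w) = T.piece i r := by
    intro i
    ext v
    simp [TubeFamily.piece, tube, Frame.slab, hT]
  have hball : ∀ i, volume.restrict (tube (L i) T.w) (ball x r) = volume (T.piece i r) := by
    intro i
    rw [Measure.restrict_apply measurableSet_ball, ← hpre,
      hmp.measure_preimage_emb (measurableEmbedding_addLeft x)]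
  have hmass : (tubesMeasure L T.w).real (ball x r) = T.mass r := by
    rw [Measure.real, tubesMeasure, Measure.finsetSum_apply, ENNReal.toReal_sum]
    · simp only [hball]
      rfl
    · intro i _
      rw [hball]
      exact (T.volume_piece_lt_top i r).ne
  have hint : ∀ (M : AffineSubspace ℝ (EuclideanSpace ℝ (Fin D))) V a,
      (∀ v, infDist (x + v) M = ‖V.nor v - a‖) →
      ∫ y in ball x r, infDist y M ^ 2 ∂(tubesMeasure L T.w) = T.sqError V a r := by
    intro M V a hM
    have hi : ∀ i, ∫ y in ball x r ∩ tube (L i) T.w, infDist y M ^ 2 =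
        ∫ v in T.piece i r, ‖V.nor v - a‖ ^ 2 := by
      intro i
      rw [← hpre, ← hmp.setIntegral_preimage_emb (measurableEmbedding_addLeft x)]
      simp only [hM]
    have hrs : (tubesMeasure L T.w).restrict (ball x r) =
        ∑ i, volume.restrict (ball x r ∩ tube (L i) T.w) := by
      ext s hs
      rw [Measure.restrict_apply hs, tubesMeasure, Measure.finsetSum_apply,
        Measure.finsetSum_apply]
      refine Finset.sum_congr rfl fun i _ => ?_
      rw [Measure.restrict_apply (hs.inter measurableSet_ball), Measure.restrict_apply hs,
        Set.inter_assoc]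
    rw [hrs, integral_finsetSum_measure]
    · simp only [hi]
      rfl
    · intro i _
      exact integrableOn_of_isBounded ((continuous_infDist_pt _).pow 2)
        (isBounded_ball.subset Set.inter_subset_left)
  have hrange : (Set.range fun M : {M : AffineSubspace ℝ (EuclideanSpace ℝ (Fin D)) //
        IsFlat d M} => √((∫ y in ball x r, infDist y M.1 ^ 2 ∂(tubesMeasure L T.w)) /
          (tubesMeasure L T.w).real (ball x r))) =
      Set.range fun p : Frame (EuclideanSpace ℝ (Fin d)) (EuclideanSpace ℝ (Fin k))
        (EuclideanSpace ℝ (Fin D)) × EuclideanSpace ℝ (Fin k) =>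
          √(T.sqError p.1 p.2 r / T.mass r) := by
    ext s
    constructor
    · rintro ⟨⟨M, hM⟩, rfl⟩
      obtain ⟨V, a, hVa⟩ := hM.exists_frame hD x
      exact ⟨(V, a), by simp only [hint M V a hVa, hmass]⟩
    · rintro ⟨⟨V, a⟩, rfl⟩
      obtain ⟨M, hM, hVa⟩ := exists_isFlat_of_frame V a x
      exact ⟨⟨M, hM⟩, by simp only [hint M V a hVa, hmass]⟩
  have hmono : Monotone fun t : ℝ => √(t / T.mass r) := fun s t hst => by
    have : 0 ≤ T.mass r := Finset.sum_nonneg fun _ _ => measureReal_nonneg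
    dsimp only
    gcongr
  have : Nonempty (Frame (EuclideanSpace ℝ (Fin d)) (EuclideanSpace ℝ (Fin k))
        (EuclideanSpace ℝ (Fin D))) := ⟨T.U (Classical.arbitrary _)⟩
  rw [beta2, iInf, hrange, TubeFamily.minError]
  congr 1
  exact (hmono.map_ciInf_of_continuousAt (Continuous.continuousAt (by fun_prop))
    (T.bddBelow_sqError r)).symm

end Reduction

/-! ### The range in which the ball meets one tube only -/

section InnerRange

variable {ι X Z E : Type*} [Fintype ι] [NormedAddCommGroup X] [InnerProductSpace ℝ X]
  [NormedAddCommGroup Z] [InnerProductSpace ℝ Z] [NormedAddCommGroup E] [InnerProductSpace ℝ E]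
  [MeasurableSpace X] [BorelSpace X] [MeasurableSpace Z] [BorelSpace Z]
  [MeasurableSpace E] [BorelSpace E]
  [FiniteDimensional ℝ X] [FiniteDimensional ℝ Z] [FiniteDimensional ℝ E]

namespace TubeFamily

/-- The Jones number of the family at the origin. -/
noncomputable def beta (T : TubeFamily ι X Z E) (r : ℝ) : ℝ := 1 / r * √(T.minError r / T.mass r)

/-- The origin lies on the central flat of the `i₀`-th tube and at distance at least `r₀` from all
other tubes. -/
structure IsCentered (T : TubeFamily ι X Z E) (i₀ : ι) (r₀ : ℝ) : Prop where
  c_eq : T.c i₀ = 0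
  w_pos : 0 < T.w
  w_lt : T.w < r₀
  le_norm_c : ∀ i, i ≠ i₀ → r₀ + T.w ≤ ‖T.c i‖

variable {T : TubeFamily ι X Z E} {i₀ : ι} {r₀ : ℝ}

lemma IsCentered.r₀_pos (h : T.IsCentered i₀ r₀) : 0 < r₀ := h.w_pos.trans h.w_lt

lemma IsCentered.lt_norm_nor (h : T.IsCentered i₀ r₀) {i : ι} (hi : i ≠ i₀) {r : ℝ} {v : E}
    (hv : v ∈ T.piece i r) : r₀ < ‖(T.U i).nor v‖ := by
  have h1 : ‖(T.U i).nor v - T.c i‖ < T.w := hv.2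
  have h2 := h.le_norm_c i hi
  have h3 := norm_sub_norm_le (T.c i) ((T.U i).nor v)
  rw [norm_sub_rev] at h3
  linarith

lemma IsCentered.piece_eq_empty (h : T.IsCentered i₀ r₀) {i : ι} (hi : i ≠ i₀) {r : ℝ}
    (hr : r ≤ r₀) : T.piece i r = ∅ := by
  refine Set.eq_empty_of_forall_notMem fun v hv => ?_
  have h1 := h.lt_norm_nor hi hv
  have h2 := (T.U i).norm_nor_le v
  have h3 : ‖v‖ < r := by simpa using hv.1
  linarith

lemma IsCentered.piece_eq (h : T.IsCentered i₀ r₀) (r : ℝ) :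
    T.piece i₀ r = ball 0 r ∩ (T.U i₀).slab 0 T.w := by
  rw [piece, h.c_eq]

lemma IsCentered.mass_eq_of_le (h : T.IsCentered i₀ r₀) {r : ℝ} (hr : r ≤ r₀) :
    T.mass r = volume.real (ball 0 r ∩ (T.U i₀).slab 0 T.w) := by
  rw [mass, Finset.sum_eq_single i₀, h.piece_eq]
  · intro i _ hi
    simp [h.piece_eq_empty hi hr]
  · simp

lemma IsCentered.sqError_eq_of_le (h : T.IsCentered i₀ r₀) {r : ℝ} (hr : r ≤ r₀)
    (V : Frame X Z E) (a : Z) :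
    T.sqError V a r = ∫ v in ball 0 r ∩ (T.U i₀).slab 0 T.w, ‖V.nor v - a‖ ^ 2 := by
  rw [sqError, Finset.sum_eq_single i₀, h.piece_eq]
  · intro i _ hi
    simp [h.piece_eq_empty hi hr]
  · simp

lemma IsCentered.minError_eq_of_le (h : T.IsCentered i₀ r₀) {r : ℝ} (hr : r ≤ r₀) :
    T.minError r = ∫ v in ball 0 r ∩ (T.U i₀).slab 0 T.w, ‖(T.U i₀).nor v‖ ^ 2 := by
  have : Nonempty (Frame X Z E) := ⟨T.U i₀⟩
  apply le_antisymm
  · refine (T.minError_le (T.U i₀) 0 r).trans_eq ?_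
    rw [h.sqError_eq_of_le hr]
    simp
  · refine le_ciInf fun p => ?_
    rw [h.sqError_eq_of_le hr]
    exact setIntegral_norm_nor_sq_le_of_slab _ _ _ _ _

/-- As long as the ball meets only the central tube, the Jones number is a function of the ratio
of the tube radius to the ball radius. -/
lemma IsCentered.beta_eq_of_le (h : T.IsCentered i₀ r₀) {r : ℝ} (h0 : 0 < r) (hr : r ≤ r₀) :
    T.beta r = √((∫ v in ball 0 1 ∩ (T.U i₀).slab 0 (T.w / r), ‖(T.U i₀).nor v‖ ^ 2) /
      volume.real (ball (0 : E) 1 ∩ (T.U i₀).slab 0 (T.w / r))) := by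
  have h1 := (T.U i₀).volume_real_ball_inter_slab_smul h0 1 (T.w / r)
  have h2 := (T.U i₀).setIntegral_ball_inter_slab_smul h0 1 (T.w / r) (T.U i₀) 0
  rw [mul_one, mul_div_cancel₀ _ h0.ne'] at h1 h2
  simp only [smul_zero, sub_zero] at h2
  rw [beta, h.minError_eq_of_le hr, h.mass_eq_of_le hr, h1, h2, ← Real.sqrt_sq (by positivity :
    0 ≤ 1 / r), ← Real.sqrt_mul (by positivity)]
  congr 1
  have : volume.real (ball (0 : E) 1 ∩ (T.U i₀).slab 0 (T.w / r)) ≠ 0 :=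
    ((T.U i₀).volume_real_ball_inter_slab_pos one_pos (div_pos h.w_pos h0)).ne'
  field_simp
  ring

lemma IsCentered.beta_const (h : T.IsCentered i₀ r₀) {r : ℝ} (hr : r ∈ Set.Ioc 0 T.w) :
    T.beta r = √((∫ v in ball (0 : E) 1, ‖(T.U i₀).nor v‖ ^ 2) / volume.real (ball (0 : E) 1)) := by
  rw [h.beta_eq_of_le hr.1 (hr.2.trans h.w_lt.le)]
  have : ball (0 : E) 1 ∩ (T.U i₀).slab 0 (T.w / r) = ball 0 1 := by
    refine Set.inter_eq_left.2 fun v hv => ?_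
    have h1 : 1 ≤ T.w / r := by rw [le_div_iff₀ hr.1]; linarith [hr.2]
    have h2 : ‖v‖ < 1 := by simpa using hv
    have h3 := (T.U i₀).norm_nor_le v
    simp only [Frame.slab, sub_zero, Set.mem_ofPred_eq]
    linarith
  rw [this]

lemma IsCentered.strictAntiOn_beta [Nontrivial Z] (h : T.IsCentered i₀ r₀) :
    StrictAntiOn T.beta (Set.Icc T.w r₀) := by
  intro r hr s hs hrs
  have hr0 : 0 < r := h.w_pos.trans_le hr.1
  have hs0 : 0 < s := h.w_pos.trans_le hs.1
  rw [h.beta_eq_of_le hr0 hr.2, h.beta_eq_of_le hs0 hs.2]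
  refine Real.sqrt_lt_sqrt (div_nonneg (integral_nonneg fun _ => by positivity)
    measureReal_nonneg) ?_
  refine (T.U i₀).mean_sq_lt_mean_sq (div_pos h.w_pos hs0) ?_ ?_
  · exact div_lt_div_of_pos_left h.w_pos hr0 hrs
  · rw [div_le_one hr0]; exact hr.1

end TubeFamily

end InnerRange

/-! ### Lower bound for the error and upper bound for the mass -/

section Boxes

variable {ι X Z E : Type*} [Fintype ι] [NormedAddCommGroup X] [InnerProductSpace ℝ X]
  [NormedAddCommGroup Z] [InnerProductSpace ℝ Z] [NormedAddCommGroup E] [InnerProductSpace ℝ E]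
  [MeasurableSpace X] [BorelSpace X] [MeasurableSpace Z] [BorelSpace Z]
  [MeasurableSpace E] [BorelSpace E]
  [FiniteDimensional ℝ X] [FiniteDimensional ℝ Z] [FiniteDimensional ℝ E]

/-- The product of a tangential ball of radius `R` and a normal ball of radius `w`, around the
point of the frame with tangential component `0` and normal component `c`. -/
def Frame.box (U : Frame X Z E) (c : Z) (R w : ℝ) : Set E :=
  {v | ‖U.tan v‖ < R ∧ ‖U.nor v - c‖ < w}

lemma Frame.isOpen_box (U : Frame X Z E) (c : Z) (R w : ℝ) : IsOpen (U.box c R w) :=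
  (isOpen_lt U.continuous_tan.norm continuous_const).inter (U.isOpen_slab c w)

lemma Frame.isBounded_box (U : Frame X Z E) (c : Z) (R w : ℝ) :
    Bornology.IsBounded (U.box c R w) := by
  refine (isBounded_ball (x := (0 : E)) (r := R + (w + ‖c‖))).subset fun v hv => ?_
  have h1 : ‖U.tan v‖ < R := hv.1
  have h2 : ‖U.nor v - c‖ < w := hv.2
  have h3 := norm_le_norm_sub_add (U.nor v) c
  have h4 := U.norm_sq_eq v
  rw [mem_ball_zero_iff]
  refine lt_of_pow_lt_pow_left₀ 2 (by linarith [norm_nonneg (U.tan v), norm_nonneg (U.nor v)]) ?_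
  nlinarith [norm_nonneg (U.tan v), norm_nonneg (U.nor v)]

lemma Frame.preimage_box (U : Frame X Z E) (c : Z) (R w : ℝ) :
    U.chart ⁻¹' U.box c R w = ball 0 R ×ˢ ball c w := by
  ext p
  simp [Frame.box, dist_eq_norm]

lemma Frame.volume_real_box (U : Frame X Z E) (c : Z) (R w : ℝ) :
    volume.real (U.box c R w) = volume.real (ball (0 : X) R) * volume.real (ball (0 : Z) w) := by
  rw [U.volume_real_chart, U.preimage_box, Measure.volume_eq_prod, measureReal_prod_prod,
    Measure.real, Measure.real, Measure.real, Measure.addHaar_ball_center _ c]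

lemma Frame.isSymmetric_box (U : Frame X Z E) (R w : ℝ) : U.IsSymmetric (U.box 0 R w) := by
  intro v v' h1 h2
  simp [Frame.box, h1, h2]

/-- The second moment of a box in a direction is at least that of its tangential factor. -/
lemma Frame.le_setIntegral_inner_sq_box [Nontrivial X] (U : Frame X Z E) {R : ℝ} (hR : 0 ≤ R)
    (w : ℝ) (u : E) :
    ‖U.tan u‖ ^ 2 * (R ^ 2 / (finrank ℝ X + 2)) * volume.real (U.box 0 R w) ≤
      ∫ v in U.box 0 R w, inner ℝ u v ^ 2 := by
  have hcn := U.continuous_nor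
  have hct := U.continuous_tan
  have hb := U.isBounded_box 0 R w
  have h1 : ∫ v in U.box 0 R w, inner ℝ (U.tan u) (U.tan v) ^ 2 =
      ‖U.tan u‖ ^ 2 * (R ^ 2 / (finrank ℝ X + 2)) * volume.real (U.box 0 R w) := by
    rw [U.setIntegral_chart, U.preimage_box, U.volume_real_box]
    simp only [Frame.tan_chart]
    have h := setIntegral_prod_mul (μ := (volume : Measure X)) (ν := (volume : Measure Z))
      (fun y => inner ℝ (U.tan u) y ^ 2) (fun _ => (1 : ℝ)) (ball 0 R) (ball 0 w)
    simp only [mul_one] at h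
    rw [Measure.volume_eq_prod, h, integral_inner_sq_ball hR]
    simp
    ring
  have hcross : ∫ v in U.box 0 R w,
      inner ℝ (U.tan u) (U.tan v) * inner ℝ (U.nor u) (U.nor v) = 0 :=
    setIntegral_eq_zero_of_antisymm
      ((U.isSymmetric_box R w).prodMap_mem (LinearIsometryEquiv.neg ℝ)
        (LinearIsometryEquiv.refl ℝ Z))
      (by simp [Frame.prodMap_apply])
  have hexp : ∀ v, inner ℝ u v ^ 2 = inner ℝ (U.tan u) (U.tan v) ^ 2 +
      2 * (inner ℝ (U.tan u) (U.tan v) * inner ℝ (U.nor u) (U.nor v)) +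
      inner ℝ (U.nor u) (U.nor v) ^ 2 := by
    intro v; rw [U.inner_eq u v]; ring
  simp only [hexp]
  rw [integral_add, integral_add, integral_const_mul, hcross, h1]
  · have : 0 ≤ ∫ v in U.box 0 R w, inner ℝ (U.nor u) (U.nor v) ^ 2 :=
      integral_nonneg fun _ => by positivity
    linarith
  all_goals exact integrableOn_of_isBounded (by fun_prop) hb

/-- The tilt between the tangential spaces of two frames: the squared Hilbert–Schmidt norm of the
orthogonal projection from the normal space of `V` to the tangential space of `U`. -/
noncomputable def Frame.tilt (U V : Frame X Z E) : ℝ :=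
  ∑ j, ‖U.tan (V.chart (0, stdOrthonormalBasis ℝ Z j))‖ ^ 2

lemma Frame.tilt_nonneg (U V : Frame X Z E) : 0 ≤ U.tilt V :=
  Finset.sum_nonneg fun _ _ => by positivity

lemma Frame.tilt_eq (U V : Frame X Z E) :
    U.tilt V = ∑ j : Fin (finrank ℝ Z), (1 - ∑ l, inner ℝ
      (U.chart (0, stdOrthonormalBasis ℝ Z l)) (V.chart (0, stdOrthonormalBasis ℝ Z j)) ^ 2) := by
  refine Finset.sum_congr rfl fun j _ => ?_
  rw [← U.norm_nor_sq_eq_sum]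
  have h1 := V.norm_chart_sq (0, stdOrthonormalBasis ℝ Z j)
  have h2 := U.norm_sq_eq (V.chart (0, stdOrthonormalBasis ℝ Z j))
  rw [h1] at h2
  simp only [norm_zero, OrthonormalBasis.norm_eq_one] at h2
  linarith

lemma Frame.tilt_comm (U V : Frame X Z E) : U.tilt V = V.tilt U := by
  rw [U.tilt_eq, V.tilt_eq, Finset.sum_sub_distrib, Finset.sum_sub_distrib, Finset.sum_comm]
  simp only [real_inner_comm]

/-- The part along the tangential space of `V` of a normal vector of `U` is controlled by the tilt.
Because the tangential spaces have equal dimension, the tilt is symmetric in the two frames; it then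
bounds the operator norm of the projection from the normal space of `U`. -/
lemma Frame.norm_tan_chart_sq_le (U V : Frame X Z E) (c : Z) :
    ‖V.tan (U.chart (0, c))‖ ^ 2 ≤ ‖c‖ ^ 2 * U.tilt V := by
  rw [U.tilt_comm V]
  set b := stdOrthonormalBasis ℝ Z
  let A : Z →ₗ[ℝ] X :=
    { toFun := fun c => V.tan (U.chart (0, c))
      map_add' := fun c c' => by rw [← map_add, ← U.chart_add]; simp
      map_smul' := fun t c => by
        rw [RingHom.id_apply, ← map_smul, ← U.chart_smul]; simp }
  have h1 : V.tan (U.chart (0, c)) = ∑ j, inner ℝ (b j) c • A (b j) := by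
    change A c = _
    conv_lhs => rw [← b.sum_repr' c]
    simp [map_sum]
  have h2 : ‖V.tan (U.chart (0, c))‖ ≤ ∑ j, |inner ℝ (b j) c| * ‖A (b j)‖ := by
    rw [h1]
    refine (norm_sum_le _ _).trans_eq ?_
    simp [norm_smul]
  calc ‖V.tan (U.chart (0, c))‖ ^ 2 ≤ (∑ j, |inner ℝ (b j) c| * ‖A (b j)‖) ^ 2 := by gcongr
    _ ≤ (∑ j, |inner ℝ (b j) c| ^ 2) * ∑ j, ‖A (b j)‖ ^ 2 := Finset.sum_mul_sq_le_sq_mul_sq _ _ _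
    _ = ‖c‖ ^ 2 * V.tilt U := by
      rw [← b.sum_sq_norm_inner_right c]
      rfl

/-- The mean squared distance from a box to a flat is at least the squared distance of its centre
plus a contribution of the tilt. -/
lemma Frame.le_setIntegral_box [Nontrivial X] (U : Frame X Z E) (c : Z) {R : ℝ} (hR : 0 ≤ R)
    (w : ℝ) (V : Frame X Z E) (a : Z) :
    (‖V.nor (U.chart (0, c)) - a‖ ^ 2 + R ^ 2 / (finrank ℝ X + 2) * U.tilt V) *
      volume.real (U.box 0 R w) ≤ ∫ v in U.box c R w, ‖V.nor v - a‖ ^ 2 := by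
  set q := U.chart (0, c)
  have hb := U.isBounded_box 0 R w
  have hcn := V.continuous_nor
  have hmp := measurePreserving_add_left (volume : Measure E) q
  have hpre : (q + ·) ⁻¹' U.box c R w = U.box 0 R w := by
    ext v
    simp [Frame.box, q]
  rw [← hmp.setIntegral_preimage_emb (measurableEmbedding_addLeft q), hpre]
  have h1 : ∀ v, ‖V.nor (q + v) - a‖ ^ 2 = ‖V.nor v - (a - V.nor q)‖ ^ 2 := by
    intro v
    rw [map_add]
    congr 2
    abel
  simp only [h1]
  rw [setIntegral_norm_sub_sq (U.isSymmetric_box R w).neg_mem hb hcn, norm_sub_rev a, add_mul,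
    add_comm]
  gcongr
  simp only [V.norm_nor_sq_eq_sum]
  rw [integral_finsetSum _ fun j _ => integrableOn_of_isBounded (by fun_prop) hb, Frame.tilt,
    Finset.mul_sum, Finset.sum_mul]
  refine Finset.sum_le_sum fun j _ => ?_
  refine le_trans (le_of_eq ?_) (U.le_setIntegral_inner_sq_box hR w _)
  ring

namespace TubeFamily

variable {T : TubeFamily ι X Z E} {i₀ : ι} {r₀ : ℝ}

lemma box_subset_piece (T : TubeFamily ι X Z E) (i : ι) {R r : ℝ} (hr : 0 ≤ r)
    (h : R ^ 2 + (‖T.c i‖ + T.w) ^ 2 ≤ r ^ 2) :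
    (T.U i).box (T.c i) R T.w ⊆ T.piece i r := by
  rintro v ⟨h1, h2⟩
  refine ⟨?_, h2⟩
  rw [mem_ball_zero_iff]
  refine lt_of_pow_lt_pow_left₀ 2 hr ?_
  have h3 := norm_le_norm_sub_add ((T.U i).nor v) (T.c i)
  have h4 := (T.U i).norm_sq_eq v
  nlinarith [norm_nonneg ((T.U i).tan v), norm_nonneg ((T.U i).nor v)]

/-- A flat that stays close to the central tube stays away from a second tube, or is tilted against
it; either way its squared error is bounded below. -/
lemma IsCentered.le_minError [Nontrivial X] (h : T.IsCentered i₀ r₀) {j : ι} (hj : j ≠ i₀)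
    {R r : ℝ} (hR : 0 ≤ R) (hr : 0 ≤ r) (hRr : R ^ 2 + (‖T.c j‖ + T.w) ^ 2 ≤ r ^ 2)
    (hRc : 2 * R ^ 2 ≤ (finrank ℝ X + 2) * ‖T.c j‖ ^ 2) :
    R ^ 2 / (finrank ℝ X + 2) * (volume.real (ball (0 : X) R) * volume.real (ball (0 : Z) T.w)) ≤
      T.minError r := by
  have : Nonempty (Frame X Z E) := ⟨T.U i₀⟩
  refine le_ciInf fun ⟨V, a⟩ => ?_
  have hb := h.w_pos
  have hcn := V.continuous_nor
  have hmono : ∀ i, R ^ 2 + (‖T.c i‖ + T.w) ^ 2 ≤ r ^ 2 →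
      ∫ v in (T.U i).box (T.c i) R T.w, ‖V.nor v - a‖ ^ 2 ≤
        ∫ v in T.piece i r, ‖V.nor v - a‖ ^ 2 := fun i hi =>
    setIntegral_mono_set (integrableOn_of_isBounded (by fun_prop) (T.isBounded_piece i r))
      (Filter.Eventually.of_forall fun _ => by positivity)
      (T.box_subset_piece i hr hi).eventuallyLE
  have h0 : R ^ 2 + (‖T.c i₀‖ + T.w) ^ 2 ≤ r ^ 2 := by
    rw [h.c_eq, norm_zero]
    nlinarith [norm_nonneg (T.c j)]
  have h1 := ((T.U i₀).le_setIntegral_box (T.c i₀) hR T.w V a).trans (hmono i₀ h0)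
  have h2 := ((T.U j).le_setIntegral_box (T.c j) hR T.w V a).trans (hmono j hRr)
  rw [Frame.volume_real_box] at h1 h2
  set m := volume.real (ball (0 : X) R) * volume.real (ball (0 : Z) T.w)
  have hm : 0 ≤ m := mul_nonneg measureReal_nonneg measureReal_nonneg
  have h3 : (∫ v in T.piece i₀ r, ‖V.nor v - a‖ ^ 2) + ∫ v in T.piece j r, ‖V.nor v - a‖ ^ 2 ≤
      T.sqError V a r := by
    classical
    rw [sqError, ← Finset.sum_pair (f := fun i => ∫ v in T.piece i r, ‖V.nor v - a‖ ^ 2) hj.symm]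
    exact Finset.sum_le_sum_of_subset_of_nonneg (Finset.subset_univ _)
      fun _ _ _ => integral_nonneg fun _ => by positivity
  refine le_trans ?_ h3
  refine le_trans ?_ (add_le_add h1 h2)
  rw [← add_mul]
  refine mul_le_mul_of_nonneg_right ?_ hm
  set q := (T.U j).chart (0, T.c j)
  have h4 : (T.U i₀).chart (0, T.c i₀) = 0 := by
    rw [h.c_eq, show ((0 : X), (0 : Z)) = 0 from rfl, Frame.chart]
    simp
  rw [h4, map_zero, zero_sub, norm_neg]
  -- the flat cannot be close to both centres, unless it is tilted towards their difference `q`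
  have h5 : ‖V.nor q‖ ^ 2 ≤ 2 * (‖a‖ ^ 2 + ‖V.nor q - a‖ ^ 2) := by
    have := norm_le_norm_sub_add (V.nor q) a
    nlinarith [norm_nonneg (V.nor q), sq_nonneg (‖V.nor q - a‖ - ‖a‖)]
  have h6 : ‖V.tan q‖ ^ 2 ≤ ‖T.c j‖ ^ 2 * (T.U j).tilt V := (T.U j).norm_tan_chart_sq_le V _
  have h7 : ‖T.c j‖ ^ 2 = ‖V.tan q‖ ^ 2 + ‖V.nor q‖ ^ 2 := by
    rw [← V.norm_sq_eq, (T.U j).norm_chart_sq]; simp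
  have h8 := (T.U i₀).tilt_nonneg V
  have h9 := (T.U j).tilt_nonneg V
  set τ := (T.U j).tilt V
  set s := R ^ 2 / ((finrank ℝ X : ℝ) + 2) with hs
  have hs0 : 0 ≤ s := by positivity
  have hs1 : s ≤ ‖T.c j‖ ^ 2 / 2 := by
    rw [hs, div_le_iff₀ (by positivity)]; linarith
  have h10 : 0 ≤ s * (T.U i₀).tilt V := mul_nonneg hs0 h8
  have h11 : s ≤ ‖a‖ ^ 2 + ‖V.nor q - a‖ ^ 2 + s * τ := by
    rcases le_total τ 1 with hτ | hτ
    · nlinarith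
    · nlinarith [sq_nonneg ‖a‖, sq_nonneg ‖V.nor q - a‖]
  linarith

/-- Any other tube meets the ball of radius `r` in tangential slices of radius at most
`√(r ^ 2 - r₀ ^ 2)`. -/
lemma IsCentered.mass_le [Nontrivial X] (h : T.IsCentered i₀ r₀) {r : ℝ} (hr : r₀ ≤ r) :
    T.mass r ≤ (r ^ finrank ℝ X + (Fintype.card ι - 1) * √(r ^ 2 - r₀ ^ 2) ^ finrank ℝ X) *
      (volume.real (ball (0 : X) 1) * volume.real (ball (0 : Z) T.w)) := by
  classical
  have hr0 : 0 ≤ r := h.r₀_pos.le.trans hr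
  have hle : ∀ i R, 0 ≤ R → T.piece i r ⊆ (T.U i).box (T.c i) R T.w →
      volume.real (T.piece i r) ≤ R ^ finrank ℝ X *
        (volume.real (ball (0 : X) 1) * volume.real (ball (0 : Z) T.w)) := by
    intro i R hR hi
    refine (measureReal_mono hi ((Frame.isBounded_box _ _ _ _).measure_lt_top.ne)).trans_eq ?_
    rw [Frame.volume_real_box, volume_real_ball hR, mul_assoc]
  rw [mass, ← Finset.add_sum_erase _ _ (Finset.mem_univ i₀), add_mul]
  refine add_le_add (hle i₀ r hr0 fun v hv => ⟨?_, hv.2⟩) ?_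
  · exact ((T.U i₀).norm_tan_le v).trans_lt (by simpa using hv.1)
  · refine (Finset.sum_le_card_nsmul _ _ _ fun i hi =>
      hle i √(r ^ 2 - r₀ ^ 2) (Real.sqrt_nonneg _) fun v hv => ⟨?_, hv.2⟩).trans_eq ?_
    · have h1 := h.lt_norm_nor (Finset.ne_of_mem_erase hi) hv
      have h2 := (T.U i).norm_sq_eq v
      have h3 : ‖v‖ < r := by simpa using hv.1
      have h4 := h.r₀_pos
      rw [Real.lt_sqrt (norm_nonneg _)]
      nlinarith [norm_nonneg v]
    · rw [Finset.card_erase_of_mem (Finset.mem_univ _), Finset.card_univ, nsmul_eq_mul,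
        Nat.cast_sub (Fintype.card_pos_iff.2 ⟨i₀⟩)]
      push_cast
      ring

end TubeFamily

end Boxes

/-! ### Increase after contact with a second tube -/

section Numerics

/-- The threshold that the width condition imposes on the mean squared relative distance to the
central flat. -/
noncomputable def meanBound (d K : ℕ) : ℝ :=
  if d = 1 then 1 / (150 * √2 * K) else 1 / (6 * (50 : ℝ) ^ ((d : ℝ) / 2) * K)

lemma rpow_half_eq (d : ℕ) : (50 : ℝ) ^ ((d : ℝ) / 2) = √50 ^ d := by
  rw [Real.sqrt_eq_rpow, ← Real.rpow_natCast, ← Real.rpow_mul (by norm_num)]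
  congr 1
  ring

lemma meanBound_nonneg (d K : ℕ) : 0 ≤ meanBound d K := by
  rw [meanBound]; split_ifs <;> positivity

lemma seven_lt_sqrt_fifty : (7 : ℝ) < √50 := by
  rw [Real.lt_sqrt (by norm_num)]; norm_num

/-- At the radius `1.0899 * r₀` the ratio `x` of the tangential radius of the second tube to the
radius of the ball exceeds `0.2986`, and the ratio `y` for the remaining tubes is below `0.4`.
The case `d = 2` is the tight one. -/
lemma meanBound_mul_le {d K : ℕ} (hd : 1 ≤ d) (hK : 2 ≤ K) {x y : ℝ} (hx : 0.2986 ≤ x)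
    (hy0 : 0 ≤ y) (hy : y ≤ 0.4) :
    meanBound d K * ((d + 2) * (1 + (K - 1) * y ^ d)) ≤ x ^ (d + 2) := by
  have hK' : (2 : ℝ) ≤ K := by exact_mod_cast hK
  rcases hd.eq_or_lt with rfl | hd
  · have h2 : (1.4 : ℝ) < √2 := by rw [Real.lt_sqrt (by norm_num)]; norm_num
    have h3 : (0.2986 : ℝ) ^ 3 ≤ x ^ (1 + 2) := by gcongr
    refine le_trans ?_ h3
    rw [meanBound, if_pos rfl, one_div, inv_mul_le_iff₀ (by positivity)]
    have h4 : 1 + ((K : ℝ) - 1) * y ^ 1 ≤ K := by rw [pow_one]; nlinarith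
    have h5 : 1.4 * (K : ℝ) ≤ √2 * K := by gcongr
    push_cast
    nlinarith
  · obtain ⟨e, rfl⟩ := Nat.exists_eq_add_of_le (show 2 ≤ d by omega)
    rw [meanBound, if_neg (by omega), rpow_half_eq, one_div, inv_mul_le_iff₀ (by positivity)]
    have h1 : y ^ (2 + e) ≤ 0.16 := by
      calc y ^ (2 + e) ≤ 0.4 ^ (2 + e) := by gcongr
        _ ≤ 0.4 ^ 2 := pow_le_pow_of_le_one (by norm_num) (by norm_num) (by omega)
        _ = 0.16 := by norm_num
    have h2 : 1 + ((K : ℝ) - 1) * y ^ (2 + e) ≤ 0.58 * K := by nlinarith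
    have h3 : (e : ℝ) + 1 ≤ 2 ^ e := by
      have : e + 1 ≤ 2 ^ e := Nat.lt_two_pow_self
      exact_mod_cast this
    have h4 : (2 : ℝ) ^ e ≤ (√50 * x) ^ e := by
      have := seven_lt_sqrt_fifty
      gcongr
      nlinarith
    have h5 : (0.08916 : ℝ) ≤ x ^ 2 := by nlinarith
    have h6 : √50 ^ (2 + e) * x ^ (2 + e + 2) = 50 * (x ^ 2 * x ^ 2) * (√50 * x) ^ e := by
      rw [pow_add, Real.sq_sqrt (by norm_num), mul_pow]; ring
    have h7 : (0.08916 : ℝ) * 0.08916 ≤ x ^ 2 * x ^ 2 := by gcongr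
    have h8 : 0.397 * (2 : ℝ) ^ e ≤ √50 ^ (2 + e) * x ^ (2 + e + 2) := by
      rw [h6]
      gcongr
      linarith
    have h9 : ((2 + e : ℕ) : ℝ) + 2 ≤ 4 * 2 ^ e := by push_cast; nlinarith
    calc (((2 + e : ℕ) : ℝ) + 2) * (1 + ((K : ℝ) - 1) * y ^ (2 + e))
        ≤ (4 * 2 ^ e) * (0.58 * K) := by
          refine mul_le_mul h9 h2 ?_ (by positivity)
          have : 0 ≤ ((K : ℝ) - 1) * y ^ (2 + e) := mul_nonneg (by linarith) (by positivity)
          linarith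
      _ ≤ 6 * (0.397 * 2 ^ e) * K := by
          have : 0 < (2 : ℝ) ^ e * K := by positivity
          nlinarith
      _ ≤ 6 * (√50 ^ (2 + e) * x ^ (2 + e + 2)) * K := by gcongr
      _ = _ := by ring

lemma le_of_lt_widthBound {d k K : ℕ} (hd : 1 ≤ d) (hk : 1 ≤ k) (hK : 2 ≤ K) {ε : ℝ} (h0 : 0 < ε)
    (h : ε < widthBound d (d + k) K) :
    ε < 0.02 ∧ (k : ℝ) / (k + 2) * ε ^ 2 < meanBound d K ∧ (d + 3) * ε ^ 2 ≤ 1 := by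
  have hk' : (1 : ℝ) ≤ k := by exact_mod_cast hk
  have hK' : (2 : ℝ) ≤ K := by exact_mod_cast hK
  rw [widthBound] at h
  by_cases h1 : d = 1
  · subst h1
    rw [if_pos rfl, lt_min_iff] at h
    obtain ⟨ha, hb⟩ := h
    refine ⟨ha, ?_, by push_cast; nlinarith⟩
    rw [Real.lt_sqrt h0.le] at hb
    push_cast at hb
    rw [show (1 : ℝ) + k + 1 = k + 2 by ring, add_sub_cancel_left,
      lt_div_iff₀ (by positivity)] at hb
    rw [meanBound, if_pos rfl, div_mul_eq_mul_div, div_lt_div_iff₀ (by positivity)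
      (by positivity)]
    linarith
  · rw [if_neg h1, lt_min_iff] at h
    obtain ⟨ha, hb⟩ := h
    rw [Real.lt_sqrt h0.le] at hb
    push_cast at hb
    rw [show (d : ℝ) + k - d + 2 = k + 2 by ring, add_sub_cancel_left,
      lt_div_iff₀ (by positivity)] at hb
    refine ⟨ha, ?_, ?_⟩
    · rw [meanBound, if_neg h1, div_mul_eq_mul_div, div_lt_div_iff₀ (by positivity)
        (by positivity)]
      linarith
    · rw [rpow_half_eq] at hb
      have h2 : (2 : ℝ) ^ d ≤ √50 ^ d := by
        have := seven_lt_sqrt_fifty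
        gcongr
        linarith
      have h3 : (d : ℝ) + 1 ≤ 2 ^ d := by
        have : d + 1 ≤ 2 ^ d := Nat.lt_two_pow_self
        exact_mod_cast this
      have h4 : (d : ℝ) + 3 ≤ 4 * √50 ^ d := by
        have : (1 : ℝ) ≤ d := by exact_mod_cast hd
        linarith
      have h5 : ε ^ 2 * (12 * √50 ^ d * k) ≤ 3 * k := by
        calc ε ^ 2 * (12 * √50 ^ d * k) = ε ^ 2 * (6 * √50 ^ d * k * 2) := by ring
          _ ≤ ε ^ 2 * (6 * √50 ^ d * k * K) := by gcongr
          _ ≤ 3 * k := by linarith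
      have h6 : 4 * √50 ^ d * ε ^ 2 ≤ 1 := by
        have : 0 < (k : ℝ) := by linarith
        nlinarith
      nlinarith [sq_nonneg ε]

end Numerics

section Increase

variable {ι X Z E : Type*} [Fintype ι] [NormedAddCommGroup X] [InnerProductSpace ℝ X]
  [NormedAddCommGroup Z] [InnerProductSpace ℝ Z] [NormedAddCommGroup E] [InnerProductSpace ℝ E]
  [MeasurableSpace X] [BorelSpace X] [MeasurableSpace Z] [BorelSpace Z]
  [MeasurableSpace E] [BorelSpace E]
  [FiniteDimensional ℝ X] [FiniteDimensional ℝ Z] [FiniteDimensional ℝ E]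

namespace TubeFamily

variable {T : TubeFamily ι X Z E} {i₀ : ι} {r₀ : ℝ}

/-- The square of the Jones number. -/
noncomputable def betaSq (T : TubeFamily ι X Z E) (r : ℝ) : ℝ :=
  T.minError r / (r ^ 2 * T.mass r)

lemma mass_nonneg (T : TubeFamily ι X Z E) (r : ℝ) : 0 ≤ T.mass r :=
  Finset.sum_nonneg fun _ _ => measureReal_nonneg

lemma minError_nonneg (T : TubeFamily ι X Z E) (r : ℝ) : 0 ≤ T.minError r :=
  Real.iInf_nonneg fun _ => T.sqError_nonneg _ _ _

lemma betaSq_nonneg (T : TubeFamily ι X Z E) (r : ℝ) : 0 ≤ T.betaSq r :=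
  div_nonneg (T.minError_nonneg r) (mul_nonneg (sq_nonneg r) (T.mass_nonneg r))

lemma beta_eq_sqrt (T : TubeFamily ι X Z E) {r : ℝ} (hr : 0 < r) :
    T.beta r = √(T.betaSq r) := by
  rw [beta, betaSq, ← Real.sqrt_sq (by positivity : 0 ≤ 1 / r),
    ← Real.sqrt_mul (by positivity), one_div, inv_pow, inv_mul_eq_div, div_div, mul_comm]

lemma beta_lt_beta_iff (T : TubeFamily ι X Z E) {r s : ℝ} (hr : 0 < r) (hs : 0 < s) :
    T.beta r < T.beta s ↔ T.betaSq r < T.betaSq s := by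
  rw [T.beta_eq_sqrt hr, T.beta_eq_sqrt hs, Real.sqrt_lt_sqrt_iff (T.betaSq_nonneg r)]

lemma IsCentered.volume_real_piece_pos (h : T.IsCentered i₀ r₀) {r : ℝ} (hr : 0 < r) :
    0 < volume.real (T.piece i₀ r) := by
  rw [h.piece_eq]
  exact (T.U i₀).volume_real_ball_inter_slab_pos hr h.w_pos

lemma volume_real_piece_le_mass (T : TubeFamily ι X Z E) (i₀ : ι) (r : ℝ) :
    volume.real (T.piece i₀ r) ≤ T.mass r :=
  Finset.single_le_sum (f := fun i => volume.real (T.piece i r))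
    (fun _ _ => measureReal_nonneg) (Finset.mem_univ i₀)

lemma IsCentered.mass_pos (h : T.IsCentered i₀ r₀) {r : ℝ} (hr : 0 < r) : 0 < T.mass r :=
  (h.volume_real_piece_pos hr).trans_le (T.volume_real_piece_le_mass i₀ r)

/-- The bound for the mean squared distance in the tube, at the moment of first contact. -/
lemma IsCentered.betaSq_r₀_le [Nontrivial Z] (h : T.IsCentered i₀ r₀) :
    T.betaSq r₀ ≤ (finrank ℝ Z : ℝ) / (finrank ℝ Z + 2) * (T.w / r₀) ^ 2 := by
  have h1 := (T.U i₀).setIntegral_norm_nor_sq_slab_le h.r₀_pos h.w_pos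
  rw [← h.minError_eq_of_le le_rfl, ← h.mass_eq_of_le le_rfl] at h1
  have h2 := h.mass_pos h.r₀_pos
  have h3 := h.r₀_pos
  rw [betaSq, div_le_iff₀ (by positivity)]
  refine h1.trans_eq ?_
  field_simp

/-- Once the ball reaches far enough into a second tube, the Jones number exceeds its value at the
moment of first contact. -/
lemma IsCentered.betaSq_lt [Nontrivial X] [Nontrivial Z] (h : T.IsCentered i₀ r₀)
    (hnear : ∀ η > 0, ∃ j, j ≠ i₀ ∧ ‖T.c j‖ < r₀ + T.w + η) (hK : 2 ≤ Fintype.card ι)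
    (hw : T.w / r₀ < 0.02)
    (hmean : (finrank ℝ Z : ℝ) / (finrank ℝ Z + 2) * (T.w / r₀) ^ 2 <
      meanBound (finrank ℝ X) (Fintype.card ι)) :
    T.betaSq r₀ < T.betaSq (1.0899 * r₀) := by
  have h0 := h.r₀_pos
  have hw' : T.w < 0.02 * r₀ := by rwa [div_lt_iff₀ h0] at hw
  have hd : 1 ≤ finrank ℝ X := finrank_pos
  obtain ⟨j, hj, hcj⟩ := hnear (0.04 * r₀ - 2 * T.w) (by linarith)
  refine (h.betaSq_r₀_le.trans_lt hmean).trans_le ?_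
  set r := 1.0899 * r₀ with hr
  have hr0 : 0 < r := by positivity
  have hcj' := h.le_norm_c j hj
  have hwp := h.w_pos
  -- the normal components of the second tube have norm less than `‖c j‖ + w < 1.04 * r₀`, and
  -- `1.04 ^ 2 = 1.0816`
  set R := √(r ^ 2 - 1.0816 * r₀ ^ 2) with hR
  have hR2 : R ^ 2 = r ^ 2 - 1.0816 * r₀ ^ 2 := Real.sq_sqrt (by rw [hr]; nlinarith)
  have hR0 : 0 ≤ R := Real.sqrt_nonneg _
  have hE := h.le_minError hj hR0 hr0.le (by rw [hR2]; nlinarith) (by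
    rw [hR2, hr]
    have : (1 : ℝ) ≤ finrank ℝ X := by exact_mod_cast hd
    have h3 : r₀ ^ 2 ≤ ‖T.c j‖ ^ 2 := by gcongr; linarith
    nlinarith)
  have hM := h.mass_le (r := r) (by rw [hr]; linarith)
  set s := √(r ^ 2 - r₀ ^ 2) with hs
  have hs2 : s ^ 2 = r ^ 2 - r₀ ^ 2 := Real.sq_sqrt (by rw [hr]; nlinarith)
  have hs0 : 0 ≤ s := Real.sqrt_nonneg _
  have hx : 0.2986 ≤ R / r := by
    rw [le_div_iff₀ hr0]
    refine le_of_sq_le_sq ?_ hR0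
    rw [hR2, hr]
    nlinarith
  have hy : s / r ≤ 0.4 := by
    rw [div_le_iff₀ hr0]
    refine le_of_sq_le_sq ?_ (by positivity)
    rw [hs2, hr]
    nlinarith
  have hnum := meanBound_mul_le hd hK hx (by positivity) hy
  rw [volume_real_ball hR0, mul_assoc] at hE
  set m := volume.real (ball (0 : X) 1) * volume.real (ball (0 : Z) T.w)
  have hm : 0 ≤ m := mul_nonneg measureReal_nonneg measureReal_nonneg
  set B := meanBound (finrank ℝ X) (Fintype.card ι)
  have hB : 0 ≤ B := meanBound_nonneg _ _
  set n := finrank ℝ X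
  rw [betaSq, le_div_iff₀ (mul_pos (by positivity) (h.mass_pos hr0))]
  refine le_trans ?_ hE
  have hmul : r ^ n + ((Fintype.card ι : ℝ) - 1) * s ^ n =
      r ^ n * (1 + ((Fintype.card ι : ℝ) - 1) * (s / r) ^ n) := by
    rw [div_pow]; field_simp
  calc B * (r ^ 2 * T.mass r)
      ≤ B * (r ^ 2 * ((r ^ n * (1 + ((Fintype.card ι : ℝ) - 1) * (s / r) ^ n)) * m)) := by
        rw [← hmul]; gcongr
    _ = (B * ((n + 2) * (1 + ((Fintype.card ι : ℝ) - 1) * (s / r) ^ n))) *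
        (r ^ (n + 2) * m / (n + 2)) := by
        field_simp
        ring
    _ ≤ (R / r) ^ (n + 2) * (r ^ (n + 2) * m / (n + 2)) := by gcongr
    _ = R ^ 2 / (n + 2) * (R ^ n * m) := by
        rw [div_pow]
        field_simp
        ring

end TubeFamily

end Increase

/-! ### Continuity of the Jones number -/

section Continuity

variable {ι X Z E : Type*} [Fintype ι] [NormedAddCommGroup X] [InnerProductSpace ℝ X]
  [NormedAddCommGroup Z] [InnerProductSpace ℝ Z] [NormedAddCommGroup E] [InnerProductSpace ℝ E]
  [MeasurableSpace X] [BorelSpace X] [MeasurableSpace Z] [BorelSpace Z]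
  [MeasurableSpace E] [BorelSpace E]
  [FiniteDimensional ℝ X] [FiniteDimensional ℝ Z] [FiniteDimensional ℝ E]

namespace TubeFamily

variable {T : TubeFamily ι X Z E} {i₀ : ι} {r₀ : ℝ}

lemma piece_mono (T : TubeFamily ι X Z E) (i : ι) {r s : ℝ} (hrs : r ≤ s) :
    T.piece i r ⊆ T.piece i s :=
  Set.inter_subset_inter_left _ (ball_subset_ball hrs)

lemma volume_real_piece_mono (T : TubeFamily ι X Z E) (i : ι) {r s : ℝ} (hrs : r ≤ s) :
    volume.real (T.piece i r) ≤ volume.real (T.piece i s) :=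
  measureReal_mono (T.piece_mono i hrs) (T.volume_piece_lt_top i s).ne

lemma mass_mono (T : TubeFamily ι X Z E) {r s : ℝ} (hrs : r ≤ s) : T.mass r ≤ T.mass s :=
  Finset.sum_le_sum fun i _ => T.volume_real_piece_mono i hrs

lemma volume_real_piece_diff (T : TubeFamily ι X Z E) (i : ι) {r s : ℝ} (hrs : r ≤ s) :
    volume.real (T.piece i s \ T.piece i r) =
      volume.real (T.piece i s) - volume.real (T.piece i r) :=
  measureReal_sdiff (T.piece_mono i hrs) (T.measurableSet_piece i r)
    (T.volume_piece_lt_top i s).ne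

/-- Only the annulus contributes to the growth of the mass. -/
lemma mass_sub_mass_le [Nontrivial E] (T : TubeFamily ι X Z E) {r s : ℝ} (hr : 0 ≤ r)
    (hrs : r ≤ s) :
    T.mass s - T.mass r ≤ Fintype.card ι * volume.real (ball (0 : E) 1) *
      (s ^ finrank ℝ E - r ^ finrank ℝ E) := by
  rw [mass, mass, ← Finset.sum_sub_distrib]
  refine (Finset.sum_le_card_nsmul _ _
    (volume.real (ball (0 : E) 1) * (s ^ finrank ℝ E - r ^ finrank ℝ E)) fun i _ => ?_).trans_eq ?_
  · rw [← T.volume_real_piece_diff i hrs]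
    have hb : volume.real (ball (0 : E) s \ ball 0 r) =
        volume.real (ball (0 : E) s) - volume.real (ball (0 : E) r) :=
      measureReal_sdiff (ball_subset_ball hrs) measurableSet_ball
    rw [volume_real_ball hr, volume_real_ball (hr.trans hrs)] at hb
    have hsub : T.piece i s \ T.piece i r ⊆ ball (0 : E) s \ ball 0 r :=
      fun v hv => ⟨hv.1.1, fun hvr => hv.2 ⟨hvr, hv.1.2⟩⟩
    refine (measureReal_mono hsub ((measure_mono Set.sdiff_subset).trans_lt
      measure_ball_lt_top).ne).trans_eq ?_
    rw [hb]
    ring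
  · rw [Finset.card_univ, nsmul_eq_mul, mul_assoc]

lemma setIntegral_piece_le (T : TubeFamily ι X Z E) (V : Frame X Z E) (a : Z) (i : ι) {r s : ℝ}
    (hrs : r ≤ s) : ∫ v in T.piece i s, ‖V.nor v - a‖ ^ 2 ≤
      (∫ v in T.piece i r, ‖V.nor v - a‖ ^ 2) + (s + ‖a‖) ^ 2 *
        (volume.real (T.piece i s) - volume.real (T.piece i r)) := by
  have hcn := V.continuous_nor
  rw [← T.volume_real_piece_diff i hrs]
  have h1 := setIntegral_sdiff (T.measurableSet_piece i r) (integrableOn_of_isBounded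
    (f := fun v => ‖V.nor v - a‖ ^ 2) (by fun_prop) (T.isBounded_piece i s)) (T.piece_mono i hrs)
  have h2 := setIntegral_mono_on (μ := volume) (f := fun v => ‖V.nor v - a‖ ^ 2)
      (g := fun _ : E => (s + ‖a‖) ^ 2) (s := T.piece i s \ T.piece i r)
      (integrableOn_of_isBounded (by fun_prop) ((T.isBounded_piece i s).subset Set.sdiff_subset))
      (integrableOn_of_isBounded (by fun_prop) ((T.isBounded_piece i s).subset Set.sdiff_subset))
      ((T.measurableSet_piece i s).diff (T.measurableSet_piece i r)) (fun v hv => by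
        have h3 : ‖v‖ < s := by simpa using hv.1.1
        have h4 := V.norm_nor_le v
        have h5 := norm_sub_le (V.nor v) a
        gcongr
        linarith)
  simp only [integral_const, measureReal_restrict_apply_univ, smul_eq_mul] at h2
  linarith

lemma sqError_le_add (T : TubeFamily ι X Z E) (V : Frame X Z E) (a : Z) {r s : ℝ}
    (hrs : r ≤ s) :
    T.sqError V a s ≤ T.sqError V a r + (s + ‖a‖) ^ 2 * (T.mass s - T.mass r) := by
  rw [sqError, sqError, mass, mass, ← Finset.sum_sub_distrib, Finset.mul_sum,
    ← Finset.sum_add_distrib]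
  exact Finset.sum_le_sum fun i _ => T.setIntegral_piece_le V a i hrs

lemma sqError_mono (T : TubeFamily ι X Z E) (V : Frame X Z E) (a : Z) {r s : ℝ}
    (hrs : r ≤ s) : T.sqError V a r ≤ T.sqError V a s := by
  have hcn := V.continuous_nor
  exact Finset.sum_le_sum fun i _ =>
    setIntegral_mono_set (integrableOn_of_isBounded (by fun_prop) (T.isBounded_piece i s))
      (Filter.Eventually.of_forall fun _ => by positivity) (T.piece_mono i hrs).eventuallyLE

/-- A flat with small mean squared error passes near the ball. -/
lemma norm_le_of_sqError_le (T : TubeFamily ι X Z E) {V : Frame X Z E} {a : Z} {r C : ℝ}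
    (hC : 0 ≤ C) (hm : 0 < T.mass r) (h : T.sqError V a r ≤ C ^ 2 * T.mass r) :
    ‖a‖ ≤ C + r := by
  by_contra! hlt
  have hcn := V.continuous_nor
  have h1 : (‖a‖ - r) ^ 2 * T.mass r ≤ T.sqError V a r := by
    rw [mass, sqError, Finset.mul_sum]
    refine Finset.sum_le_sum fun i _ => ?_
    have h2 := setIntegral_mono_on (μ := volume) (g := fun v => ‖V.nor v - a‖ ^ 2)
      (f := fun _ : E => (‖a‖ - r) ^ 2) (s := T.piece i r)
      (integrableOn_of_isBounded (by fun_prop) (T.isBounded_piece i r))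
      (integrableOn_of_isBounded (by fun_prop) (T.isBounded_piece i r))
      (T.measurableSet_piece i r) (fun v hv => by
        have h3 : ‖v‖ < r := by simpa using hv.1
        have h4 := V.norm_nor_le v
        have h5 := norm_sub_norm_le a (V.nor v)
        rw [norm_sub_rev] at h5
        have : 0 ≤ ‖a‖ - r := by linarith
        gcongr
        linarith)
    simp only [integral_const, measureReal_restrict_apply_univ, smul_eq_mul] at h2
    linarith
  have h3 : C ^ 2 < (‖a‖ - r) ^ 2 := by
    gcongr
    linarith
  nlinarith

lemma exists_sqError_lt [Nonempty (Frame X Z E)] (T : TubeFamily ι X Z E) {r t : ℝ}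
    (ht : T.minError r < t) : ∃ V a, T.sqError V a r < t := by
  obtain ⟨⟨V, a⟩, hVa⟩ := exists_lt_of_ciInf_lt ht
  exact ⟨V, a, hVa⟩

lemma minError_mono [Nonempty (Frame X Z E)] (T : TubeFamily ι X Z E) {r s : ℝ} (hrs : r ≤ s) :
    T.minError r ≤ T.minError s :=
  le_ciInf fun p => (T.minError_le p.1 p.2 r).trans (T.sqError_mono _ _ hrs)

lemma minError_le_mul_mass [Nonempty (Frame X Z E)] (T : TubeFamily ι X Z E) {r : ℝ}
    (hr : 0 ≤ r) : T.minError r ≤ r ^ 2 * T.mass r := by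
  obtain ⟨V⟩ := ‹Nonempty (Frame X Z E)›
  refine (T.minError_le V 0 r).trans ?_
  have h1 := T.sqError_le_add V 0 hr
  have h2 : ∀ i, T.piece i 0 = ∅ := fun i => by simp [piece]
  simpa [sqError, mass, h2] using h1

lemma IsCentered.minError_sub_le (h : T.IsCentered i₀ r₀) {r s : ℝ} (hr : 0 < r) (hrs : r ≤ s) :
    T.minError s - T.minError r ≤ (4 * s) ^ 2 * (T.mass s - T.mass r) := by
  have hm := h.mass_pos hr
  have : Nonempty (Frame X Z E) := ⟨T.U i₀⟩
  rw [sub_le_iff_le_add]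
  refine le_of_forall_pos_lt_add fun η hη => ?_
  obtain ⟨V, a, hVa⟩ := T.exists_sqError_lt (r := r)
    (t := T.minError r + min η (3 * r ^ 2 * T.mass r))
    (lt_add_of_pos_right _ (lt_min hη (by positivity)))
  have h1 : ‖a‖ ≤ 2 * r + r := by
    refine T.norm_le_of_sqError_le (V := V) (by positivity) hm ?_
    · have := min_le_right η (3 * r ^ 2 * T.mass r)
      have := T.minError_le_mul_mass hr.le
      nlinarith
  have h2 := (T.minError_le V a s).trans (T.sqError_le_add V a hrs)
  have h3 : (s + ‖a‖) ^ 2 * (T.mass s - T.mass r) ≤ (4 * s) ^ 2 * (T.mass s - T.mass r) := by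
    have := sub_nonneg.2 (T.mass_mono hrs)
    have := norm_nonneg a
    gcongr
    all_goals linarith
  have := min_le_left η (3 * r ^ 2 * T.mass r)
  linarith

lemma continuousAt_of_sub_le {f g : ℝ → ℝ} {r C : ℝ} (hr : 0 < r)
    (hf : ∀ s t, 0 < s → s ≤ t → t ≤ 2 * r → f s ≤ f t ∧ f t - f s ≤ C * (g t - g s))
    (hg : ContinuousAt g r) : ContinuousAt f r := by
  have h0 : Filter.Tendsto (fun s => |C * (g s - g r)|) (nhds r) (nhds 0) := by
    have h1 : ContinuousAt (fun s => |C * (g s - g r)|) r := by fun_prop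
    have h2 := h1.tendsto
    simpa using h2
  rw [ContinuousAt, tendsto_iff_dist_tendsto_zero]
  refine squeeze_zero' (Filter.Eventually.of_forall fun _ => dist_nonneg) ?_ h0
  filter_upwards [Ioo_mem_nhds hr (show r < 2 * r by linarith)] with s hs
  rw [Real.dist_eq]
  rcases le_total s r with hsr | hsr
  · obtain ⟨h1, h2⟩ := hf s r hs.1 hsr (by linarith)
    rw [abs_sub_comm, abs_of_nonneg (by linarith), ← abs_neg]
    exact h2.trans ((le_of_eq (by ring)).trans (le_abs_self _))
  · obtain ⟨h1, h2⟩ := hf r s hr hsr hs.2.le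
    rw [abs_of_nonneg (by linarith)]
    exact h2.trans (le_abs_self _)

lemma continuousAt_mass [Nontrivial E] (T : TubeFamily ι X Z E) {r : ℝ} (hr : 0 < r) :
    ContinuousAt T.mass r :=
  continuousAt_of_sub_le (g := fun r => r ^ finrank ℝ E) hr
    (fun _ _ hs hst _ => ⟨T.mass_mono hst, T.mass_sub_mass_le hs.le hst⟩)
    (by fun_prop)

lemma IsCentered.continuousAt_minError [Nontrivial E] (h : T.IsCentered i₀ r₀) {r : ℝ}
    (hr : 0 < r) : ContinuousAt T.minError r :=
  have : Nonempty (Frame X Z E) := ⟨T.U i₀⟩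
  continuousAt_of_sub_le (g := T.mass) (C := (4 * (2 * r)) ^ 2) hr
    (fun s t hs hst ht => ⟨T.minError_mono hst, (h.minError_sub_le hs hst).trans (by
      have := sub_nonneg.2 (T.mass_mono hst)
      have : 0 < t := hs.trans_le hst
      gcongr)⟩)
    (T.continuousAt_mass hr)

lemma IsCentered.continuousAt_beta [Nontrivial E] (h : T.IsCentered i₀ r₀) {r : ℝ}
    (hr : 0 < r) : ContinuousAt T.beta r := by
  have h1 := h.continuousAt_minError hr
  have h2 := T.continuousAt_mass hr
  exact ((continuousAt_const.div continuousAt_id hr.ne').mul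
    (h1.div h2 (h.mass_pos hr).ne').sqrt)

end TubeFamily

end Continuity

/-! ### Mass gained just after contact -/

section Cones

open scoped Pointwise

variable {E : Type*} [NormedAddCommGroup E] [InnerProductSpace ℝ E]
  [MeasurableSpace E] [BorelSpace E] [FiniteDimensional ℝ E]

/-- The part in the ball of radius `s` of the circular cone around `e`, where `t` is the cosine of
the opening angle. -/
def ballCone (e : E) (t s : ℝ) : Set E := {v | ‖v‖ < s ∧ t * ‖v‖ ≤ inner ℝ e v}

lemma measurableSet_ballCone (e : E) (t s : ℝ) : MeasurableSet (ballCone e t s) := by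
  have h1 : MeasurableSet {v : E | ‖v‖ < s} := measurableSet_lt (by fun_prop) (by fun_prop)
  have h2 : MeasurableSet {v : E | t * ‖v‖ ≤ inner ℝ e v} :=
    measurableSet_le (by fun_prop) (by fun_prop)
  exact h1.inter h2

lemma volume_ballCone_lt_top (e : E) (t s : ℝ) : volume (ballCone e t s) < ⊤ :=
  (measure_mono (t := ball 0 s) fun _ hv => by simpa using hv.1).trans_lt measure_ball_lt_top

lemma volume_real_ballCone (e : E) (t : ℝ) {s : ℝ} (hs : 0 < s) :
    volume.real (ballCone e t s) = s ^ finrank ℝ E * volume.real (ballCone e t 1) := by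
  have h : ballCone e t s = s • ballCone e t 1 := by
    ext v
    rw [Set.mem_smul_set_iff_inv_smul_mem₀ hs.ne']
    simp only [ballCone, Set.mem_ofPred_eq, norm_smul, norm_inv, Real.norm_eq_abs, abs_of_pos hs,
      inner_smul_right, inv_mul_lt_iff₀ hs, mul_one]
    rw [mul_left_comm, mul_le_mul_iff_of_pos_left (by positivity)]
  rw [h, Measure.real, Measure.addHaar_smul, ENNReal.toReal_mul,
    ENNReal.toReal_ofReal (by positivity), abs_of_pos (by positivity), Measure.real]

/-- The volume of a cone tends to zero with its opening angle, because a line is a null set. -/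
lemma exists_volume_ballCone_lt (hE : 2 ≤ finrank ℝ E) {e : E} (he : ‖e‖ = 1) {η : ℝ}
    (hη : 0 < η) : ∃ t < 1, volume.real (ballCone e t 1) < η := by
  set t : ℕ → ℝ := fun n => 1 - 1 / ((n : ℝ) + 1) with ht
  have hmono : Antitone fun n => ballCone e (t n) 1 := by
    intro m n hmn v hv
    refine ⟨hv.1, le_trans ?_ hv.2⟩
    have : t m ≤ t n := by simp only [ht]; gcongr
    gcongr
  have hlim : Filter.Tendsto t Filter.atTop (nhds 1) := by
    have := (tendsto_one_div_add_atTop_nhds_zero_nat (𝕜 := ℝ)).const_sub 1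
    simpa only [sub_zero] using this
  have hnull : volume (⋂ n, ballCone e (t n) 1) = 0 := by
    refine measure_mono_null (t := (ℝ ∙ e : Submodule ℝ E)) ?_ ?_
    · intro v hv
      have h1 : ‖v‖ ≤ inner ℝ e v := by
        have h2 : ∀ n, t n * ‖v‖ ≤ inner ℝ e v := fun n => (Set.mem_iInter.1 hv n).2
        have h3 := hlim.mul_const ‖v‖
        rw [one_mul] at h3
        exact le_of_tendsto h3 (Filter.Eventually.of_forall h2)
      have h4 : inner ℝ e v = ‖e‖ * ‖v‖ :=
        le_antisymm (real_inner_le_norm e v) (by rw [he, one_mul]; exact h1)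
      rw [inner_eq_norm_mul_iff_real, he, one_smul] at h4
      rw [← h4]
      exact Submodule.smul_mem _ _ (Submodule.mem_span_singleton_self e)
    · refine Measure.addHaar_submodule _ _ fun htop => ?_
      have h1 := finrank_span_singleton (K := ℝ) (v := e) (by rintro rfl; simp at he)
      rw [htop, finrank_top] at h1
      omega
  have htend := tendsto_measure_iInter_atTop (μ := (volume : Measure E))
    (s := fun n => ballCone e (t n) 1)
    (fun n => (measurableSet_ballCone e (t n) 1).nullMeasurableSet) hmono
    ⟨0, (volume_ballCone_lt_top e (t 0) 1).ne⟩
  rw [hnull] at htend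
  have hreal : Filter.Tendsto (fun n => volume.real (ballCone e (t n) 1)) Filter.atTop
      (nhds 0) := by
    exact (ENNReal.tendsto_toReal (a := 0) (by simp)).comp htend
  obtain ⟨n, hn⟩ := (hreal.eventually_lt_const hη).exists
  refine ⟨t n, ?_, hn⟩
  have : (0 : ℝ) < 1 / ((n : ℝ) + 1) := by positivity
  simp only [ht]
  linarith

/-- A first-order bound for the growth of powers, from Bernoulli's inequality. -/
lemma pow_sub_pow_le {r s : ℝ} (hr : 0 ≤ r) (hs : 0 < s) (n : ℕ) :
    s ^ n - r ^ n ≤ n * s ^ n * ((s - r) / s) := by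
  have h1 := one_add_mul_le_pow (a := -((s - r) / s)) (by
    have : (s - r) / s ≤ 1 := by rw [div_le_one hs]; linarith
    linarith) n
  have h2 : r ^ n = s ^ n * (1 + -((s - r) / s)) ^ n := by
    rw [← mul_pow]
    congr 1
    field_simp
    ring
  have h3 : s ^ n * (1 + n * -((s - r) / s)) ≤ r ^ n := by rw [h2]; gcongr
  linarith

end Cones

section Contact

variable {ι X Z E : Type*} [Fintype ι] [NormedAddCommGroup X] [InnerProductSpace ℝ X]
  [NormedAddCommGroup Z] [InnerProductSpace ℝ Z] [NormedAddCommGroup E] [InnerProductSpace ℝ E]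
  [MeasurableSpace X] [BorelSpace X] [MeasurableSpace Z] [BorelSpace Z]
  [MeasurableSpace E] [BorelSpace E]
  [FiniteDimensional ℝ X] [FiniteDimensional ℝ Z] [FiniteDimensional ℝ E]

namespace TubeFamily

variable {T : TubeFamily ι X Z E} {i₀ : ι} {r₀ : ℝ}

/-- Any other tube lies in the half-space at distance `r₀` from the origin. -/
lemma IsCentered.lt_inner (h : T.IsCentered i₀ r₀) {i : ι} (hi : i ≠ i₀) {r : ℝ} {v : E}
    (hv : v ∈ T.piece i r) :
    r₀ < inner ℝ (‖T.c i‖⁻¹ • (T.U i).chart (0, T.c i)) v := by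
  have h1 : ‖(T.U i).nor v - T.c i‖ < T.w := hv.2
  have h2 := h.le_norm_c i hi
  have h3 : 0 < ‖T.c i‖ := by linarith [h.w_pos, h.r₀_pos]
  rw [inner_smul_left, (T.U i).inner_chart, conj_trivial, lt_inv_mul_iff₀ h3]
  simp only [inner_zero_left, zero_add]
  have h4 := abs_real_inner_le_norm (T.c i) ((T.U i).nor v - T.c i)
  rw [inner_sub_right, real_inner_self_eq_norm_sq] at h4
  have h5 := neg_le_of_abs_le h4
  nlinarith

/-- Just after the first contact the other tubes gain mass at an arbitrarily small rate, since
their new points lie in a thin cone. -/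
lemma IsCentered.exists_volume_piece_sub_le (hE : 2 ≤ finrank ℝ E) (h : T.IsCentered i₀ r₀)
    {i : ι} (hi : i ≠ i₀) {η : ℝ} (hη : 0 < η) :
    ∃ δ > 0, ∀ r s, r₀ ≤ r → r ≤ s → s ≤ r₀ + δ →
      volume.real (T.piece i s) - volume.real (T.piece i r) ≤ η * (s - r) := by
  have h0 := h.r₀_pos
  set e := ‖T.c i‖⁻¹ • (T.U i).chart (0, T.c i) with he
  have he1 : ‖e‖ = 1 := by
    have h2 := h.le_norm_c i hi
    have h3 : 0 < ‖T.c i‖ := by linarith [h.w_pos, h.r₀_pos]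
    have h4 : ‖(T.U i).chart (0, T.c i)‖ = ‖T.c i‖ := by
      rw [← sq_eq_sq₀ (norm_nonneg _) (norm_nonneg _), (T.U i).norm_chart_sq]; simp
    rw [he, norm_smul, h4, norm_inv, norm_norm, inv_mul_cancel₀ h3.ne']
  have hn : 0 < finrank ℝ E := by omega
  set n := finrank ℝ E
  set η' := η / (n * (2 * r₀) ^ n / r₀) with hη'
  obtain ⟨t, ht, hvol⟩ := exists_volume_ballCone_lt hE he1 (show 0 < η' by positivity)
  -- the maximum with `1 / 2` ensures `s ≤ 2 * r₀`
  have ht0 : 0 < max t (1 / 2) := lt_max_of_lt_right (by norm_num)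
  have ht1 : max t (1 / 2) < 1 := max_lt ht (by norm_num)
  refine ⟨r₀ / max t (1 / 2) - r₀, ?_, fun r s hr hrs hs => ?_⟩
  · rw [gt_iff_lt, sub_pos, lt_div_iff₀ ht0]
    nlinarith
  rw [add_sub_cancel, le_div_iff₀ ht0] at hs
  have hs0 : 0 < s := by linarith
  have hr0 : 0 < r := by linarith
  have hts : t * s ≤ r₀ := by
    have := le_max_left t (1 / 2)
    nlinarith
  have hs2 : s ≤ 2 * r₀ := by
    have := le_max_right t (1 / 2)
    nlinarith
  have hsub : T.piece i s \ T.piece i r ⊆ ballCone e t s \ ballCone e t r := by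
    rintro v ⟨hv, hvr⟩
    have h1 : ‖v‖ < s := by simpa using hv.1
    refine ⟨⟨h1, ?_⟩, fun hvc => hvr ⟨by simpa using hvc.1, hv.2⟩⟩
    have h2 := h.lt_inner hi hv
    rcases le_total t 0 with ht' | ht'
    · exact (mul_nonpos_of_nonpos_of_nonneg ht' (norm_nonneg _)).trans (h0.trans h2).le
    · have : t * ‖v‖ ≤ t * s := by gcongr
      linarith
  have hcone : ballCone e t r ⊆ ballCone e t s := fun v hv => ⟨hv.1.trans_le hrs, hv.2⟩
  rw [← T.volume_real_piece_diff i hrs]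
  refine (measureReal_mono hsub ((measure_mono Set.sdiff_subset).trans_lt
    (volume_ballCone_lt_top e t s)).ne).trans ?_
  rw [measureReal_sdiff hcone (measurableSet_ballCone e t r) (volume_ballCone_lt_top e t s).ne,
    volume_real_ballCone e t hs0, volume_real_ballCone e t hr0, ← sub_mul]
  have h1 := pow_sub_pow_le hr0.le hs0 n
  have h2 : n * s ^ n * ((s - r) / s) ≤ (n * (2 * r₀) ^ n / r₀) * (s - r) := by
    rw [mul_div_assoc', mul_div_right_comm]
    gcongr
    linarith
  calc (s ^ n - r ^ n) * volume.real (ballCone e t 1)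
      ≤ ((n * (2 * r₀) ^ n / r₀) * (s - r)) * η' := by
        refine mul_le_mul (h1.trans h2) hvol.le measureReal_nonneg ?_
        have : 0 ≤ s - r := by linarith
        positivity
    _ = η * (s - r) := by rw [hη']; field_simp

lemma IsCentered.exists_forall_volume_piece_sub_le (hE : 2 ≤ finrank ℝ E)
    (h : T.IsCentered i₀ r₀) {η : ℝ} (hη : 0 < η) :
    ∃ δ > 0, ∀ i ≠ i₀, ∀ r s, r₀ ≤ r → r ≤ s → s ≤ r₀ + δ →
      volume.real (T.piece i s) - volume.real (T.piece i r) ≤ η * (s - r) := by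
  have hex : ∀ i, ∃ δ > 0, i ≠ i₀ → ∀ r s, r₀ ≤ r → r ≤ s → s ≤ r₀ + δ →
      volume.real (T.piece i s) - volume.real (T.piece i r) ≤ η * (s - r) := by
    intro i
    by_cases hi : i = i₀
    · exact ⟨1, one_pos, fun h' => absurd hi h'⟩
    · obtain ⟨δ, hδ, hi'⟩ := h.exists_volume_piece_sub_le hE hi hη
      exact ⟨δ, hδ, fun _ => hi'⟩
  choose δ hδ hspec using hex
  obtain ⟨i, -, hi⟩ := Finset.exists_min_image Finset.univ δ ⟨i₀, Finset.mem_univ _⟩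
  exact ⟨δ i, hδ i, fun j hj r s h1 h2 h3 =>
    hspec j hj r s h1 h2 (h3.trans (by linarith [hi j (Finset.mem_univ j)]))⟩

end TubeFamily

/-- The volume lost by the central tube under rescaling is of first order. -/
lemma Frame.le_volume_real_shell [Nontrivial X] [Nontrivial Z] (U : Frame X Z E)
    {R r w t : ℝ} (hr : 0 ≤ r) (hw : 0 < w) (hRr : R ^ 2 + w ^ 2 ≤ r ^ 2)
    (ht0 : 0 < t) (ht1 : t ≤ 1) :
    volume.real (U.box 0 R w) * (1 - t) ≤ volume.real (U.shell r (t * w) w) := by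
  have htw : t * w ≤ w := by nlinarith
  have hk : 1 ≤ finrank ℝ Z := finrank_pos
  have hsub : U.box 0 R (t * w) ⊆ U.box 0 R w := fun v hv => ⟨hv.1, hv.2.trans_le htw⟩
  have hdiff : U.box 0 R w \ U.box 0 R (t * w) ⊆ U.shell r (t * w) w := by
    rintro v ⟨⟨h1, h2⟩, h3⟩
    refine ⟨⟨?_, h2⟩, fun h4 => h3 ⟨h1, h4⟩⟩
    rw [sub_zero] at h2
    rw [mem_ball_zero_iff]
    refine lt_of_pow_lt_pow_left₀ 2 hr ?_
    rw [U.norm_sq_eq]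
    nlinarith [norm_nonneg (U.tan v), norm_nonneg (U.nor v)]
  refine le_trans ?_ (measureReal_mono hdiff (U.isBounded_shell r (t * w) w).measure_lt_top.ne)
  rw [measureReal_sdiff hsub (U.isOpen_box 0 R (t * w)).measurableSet
    (U.isBounded_box 0 R w).measure_lt_top.ne, U.volume_real_box, U.volume_real_box,
    volume_real_ball hw.le, volume_real_ball (by positivity : 0 ≤ t * w), mul_pow]
  have h1 : t ^ finrank ℝ Z ≤ t := pow_le_of_le_one ht0.le ht1 (by omega)
  have h2 : 0 ≤ volume.real (ball (0 : X) R) * (w ^ finrank ℝ Z * volume.real (ball (0 : Z) 1)) :=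
    mul_nonneg measureReal_nonneg (mul_nonneg (by positivity) measureReal_nonneg)
  nlinarith

end Contact

/-! ### Rescaling past the first contact -/

section Decrease

variable {ι X Z E : Type*} [Fintype ι] [NormedAddCommGroup X] [InnerProductSpace ℝ X]
  [NormedAddCommGroup Z] [InnerProductSpace ℝ Z] [NormedAddCommGroup E] [InnerProductSpace ℝ E]
  [MeasurableSpace X] [BorelSpace X] [MeasurableSpace Z] [BorelSpace Z]
  [MeasurableSpace E] [BorelSpace E]
  [FiniteDimensional ℝ X] [FiniteDimensional ℝ Z] [FiniteDimensional ℝ E]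

lemma Frame.ball_inter_slab_inter (U : Frame X Z E) (r : ℝ) {w' w : ℝ} (hw : w' ≤ w) :
    (ball 0 r ∩ U.slab 0 w) ∩ U.slab 0 w' = ball 0 r ∩ U.slab 0 w' := by
  rw [Set.inter_assoc]
  congr 1
  exact Set.inter_eq_right.2 fun v hv => lt_of_lt_of_le hv hw

namespace TubeFamily

variable {T : TubeFamily ι X Z E} {i₀ : ι} {r₀ : ℝ}

/-- Rescaling the ball, while the tube radius stays fixed, costs the central tube a shell. -/
lemma IsCentered.setIntegral_rescale (h : T.IsCentered i₀ r₀) {r s : ℝ} (hr : 0 < r)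
    (hrs : r ≤ s) (V : Frame X Z E) (a : Z) :
    ∫ v in T.piece i₀ s, ‖V.nor v - (s / r) • a‖ ^ 2 = (s / r) ^ (finrank ℝ E + 2) *
      ((∫ v in T.piece i₀ r, ‖V.nor v - a‖ ^ 2) -
        ∫ v in (T.U i₀).shell r (r / s * T.w) T.w, ‖V.nor v - a‖ ^ 2) := by
  have hs : 0 < s := hr.trans_le hrs
  have hcn := V.continuous_nor
  have h1 := (T.U i₀).setIntegral_ball_inter_slab_smul (div_pos hs hr) r (r / s * T.w) V a
  rw [div_mul_cancel₀ _ hr.ne', ← mul_assoc, div_mul_div_cancel₀ hr.ne', div_self hs.ne',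
    one_mul] at h1
  rw [h.piece_eq, h.piece_eq, h1]
  congr 1
  have hle : r / s * T.w ≤ T.w := by
    have : r / s ≤ 1 := by rw [div_le_one hs]; exact hrs
    nlinarith [h.w_pos]
  rw [← (T.U i₀).ball_inter_slab_inter r hle, eq_sub_iff_add_eq]
  exact integral_inter_add_sdiff ((T.U i₀).isOpen_slab 0 _).measurableSet
    (integrableOn_of_isBounded (by fun_prop) (isBounded_ball.subset Set.inter_subset_left))

lemma IsCentered.volume_real_rescale (h : T.IsCentered i₀ r₀) {r s : ℝ} (hr : 0 < r)
    (hrs : r ≤ s) :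
    volume.real (T.piece i₀ s) = (s / r) ^ finrank ℝ E *
      (volume.real (T.piece i₀ r) - volume.real ((T.U i₀).shell r (r / s * T.w) T.w)) := by
  have hs : 0 < s := hr.trans_le hrs
  have h1 := (T.U i₀).volume_real_ball_inter_slab_smul (div_pos hs hr) r (r / s * T.w)
  rw [div_mul_cancel₀ _ hr.ne', ← mul_assoc, div_mul_div_cancel₀ hr.ne', div_self hs.ne',
    one_mul] at h1
  rw [h.piece_eq, h.piece_eq, h1]
  congr 1
  have hle : r / s * T.w ≤ T.w := by
    have : r / s ≤ 1 := by rw [div_le_one hs]; exact hrs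
    nlinarith [h.w_pos]
  rw [← (T.U i₀).ball_inter_slab_inter r hle, eq_sub_iff_add_eq]
  exact measureReal_inter_add_sdiff ((T.U i₀).isOpen_slab 0 _).measurableSet
    ((measure_mono Set.inter_subset_left).trans_lt measure_ball_lt_top).ne

/-- In any tube, rescaling a flat that passes near the ball changes the squared error by an amount of
first order in `s - r` times the mass, plus the contribution of the new points. -/
lemma setIntegral_piece_rescale_le (T : TubeFamily ι X Z E) (i : ι) {r s : ℝ} (hr : 0 < r)
    (hrs : r ≤ s) (hs : s ≤ 2 * r) (V : Frame X Z E) {a : Z} (ha : ‖a‖ ≤ 2 * r) :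
    ∫ v in T.piece i s, ‖V.nor v - (s / r) • a‖ ^ 2 ≤
      (∫ v in T.piece i r, ‖V.nor v - a‖ ^ 2) + 16 * r * (s - r) * volume.real (T.piece i r) +
        36 * r ^ 2 * (volume.real (T.piece i s) - volume.real (T.piece i r)) := by
  have hcn := V.continuous_nor
  have hb := T.isBounded_piece i r
  have hsr : 1 ≤ s / r := by rwa [le_div_iff₀ hr, one_mul]
  have h1 : ‖(s / r) • a‖ ≤ 2 * s := by
    rw [norm_smul, Real.norm_eq_abs, abs_of_nonneg (by positivity)]
    calc s / r * ‖a‖ ≤ s / r * (2 * r) := by gcongr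
      _ = 2 * s := by field_simp
  have h2 : ‖(s / r) • a - a‖ ≤ 2 * (s - r) := by
    rw [show (s / r) • a - a = (s / r - 1) • a by rw [sub_smul, one_smul], norm_smul,
      Real.norm_eq_abs, abs_of_nonneg (by linarith)]
    calc (s / r - 1) * ‖a‖ ≤ (s / r - 1) * (2 * r) := by gcongr
      _ = 2 * (s - r) := by field_simp
  have h3 : (s + ‖(s / r) • a‖) ^ 2 * (volume.real (T.piece i s) - volume.real (T.piece i r)) ≤
      36 * r ^ 2 * (volume.real (T.piece i s) - volume.real (T.piece i r)) := by
    have h4 := sub_nonneg.2 (T.volume_real_piece_mono i hrs)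
    refine mul_le_mul_of_nonneg_right ?_ h4
    have : s + ‖(s / r) • a‖ ≤ 6 * r := by linarith
    have h5 : 0 ≤ s + ‖(s / r) • a‖ := by linarith [norm_nonneg ((s / r) • a)]
    nlinarith
  have h4 : ∫ v in T.piece i r, ‖V.nor v - (s / r) • a‖ ^ 2 ≤
      ∫ v in T.piece i r, (‖V.nor v - a‖ ^ 2 + 16 * r * (s - r)) := by
    refine setIntegral_mono_on (integrableOn_of_isBounded (by fun_prop) hb)
      (integrableOn_of_isBounded (by fun_prop) hb) (T.measurableSet_piece i r) fun v hv => ?_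
    have h5 : ‖v‖ < r := by simpa using hv.1
    have h6 := V.norm_nor_le v
    have h7 : ‖V.nor v - a‖ ≤ 3 * r := (norm_sub_le _ _).trans (by linarith)
    have h8 : ‖V.nor v - (s / r) • a‖ ≤ ‖V.nor v - a‖ + 2 * (s - r) := by
      have : V.nor v - (s / r) • a = (V.nor v - a) - ((s / r) • a - a) := by abel
      rw [this]
      exact (norm_sub_le _ _).trans (by linarith)
    have h9 : ‖V.nor v - (s / r) • a‖ ^ 2 ≤ (‖V.nor v - a‖ + 2 * (s - r)) ^ 2 := by gcongr
    nlinarith [norm_nonneg (V.nor v - a)]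
  rw [integral_add (integrableOn_of_isBounded (by fun_prop) hb)
    (integrableOn_of_isBounded (by fun_prop) hb)] at h4
  simp only [integral_const, measureReal_restrict_apply_univ, smul_eq_mul] at h4
  have h5 := T.setIntegral_piece_le V ((s / r) • a) i hrs
  linarith

/-- The effect of rescaling on the squared error: the central tube loses a shell, and the other
tubes, whose mass grows at rate at most `η`, gain little. -/
lemma IsCentered.sqError_rescale_le (h : T.IsCentered i₀ r₀) {r s η : ℝ} (hr : r₀ ≤ r)
    (hrs : r ≤ s) (hs : s ≤ 2 * r₀) (hη : 0 < η)
    (hsmall : ∀ i ≠ i₀, volume.real (T.piece i s) - volume.real (T.piece i r) ≤ η * (s - r))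
    (hsmall' : ∀ i ≠ i₀, volume.real (T.piece i r) ≤ η * r)
    (V : Frame X Z E) {a : Z} (ha : ‖a‖ ≤ 2 * r) :
    T.sqError V ((s / r) • a) s ≤ (s / r) ^ (finrank ℝ E + 2) * (T.sqError V a r -
      (∫ v in (T.U i₀).shell r (r / s * T.w) T.w, ‖V.nor v - a‖ ^ 2) +
        Fintype.card ι * (52 * r ^ 2 * η * (s - r))) := by
  classical
  have hr0 : 0 < r := h.r₀_pos.trans_le hr
  have hl : 1 ≤ (s / r) ^ (finrank ℝ E + 2) := by
    refine one_le_pow₀ ?_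
    rwa [le_div_iff₀ hr0, one_mul]
  have hsr : 0 ≤ s - r := by linarith
  have hoth : ∀ i ∈ Finset.univ.erase i₀, ∫ v in T.piece i s, ‖V.nor v - (s / r) • a‖ ^ 2 ≤
      (∫ v in T.piece i r, ‖V.nor v - a‖ ^ 2) + 52 * r ^ 2 * η * (s - r) := by
    intro i hi
    have hi' := Finset.ne_of_mem_erase hi
    have h1 := T.setIntegral_piece_rescale_le i hr0 hrs (by linarith) V ha
    have h2 : 16 * r * (s - r) * volume.real (T.piece i r) ≤ 16 * r * (s - r) * (η * r) := by
      gcongr; exact hsmall' i hi'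
    have h3 : 36 * r ^ 2 * (volume.real (T.piece i s) - volume.real (T.piece i r)) ≤
        36 * r ^ 2 * (η * (s - r)) := by
      gcongr; exact hsmall i hi'
    linarith
  have hsum := Finset.sum_le_sum hoth
  rw [Finset.sum_add_distrib, Finset.sum_const, nsmul_eq_mul] at hsum
  have hcard : ((Finset.univ.erase i₀).card : ℝ) * (52 * r ^ 2 * η * (s - r)) ≤
      Fintype.card ι * (52 * r ^ 2 * η * (s - r)) := by
    gcongr
    exact Finset.card_le_univ _
  have hB0 : 0 ≤ ∑ i ∈ Finset.univ.erase i₀, ∫ v in T.piece i r, ‖V.nor v - a‖ ^ 2 :=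
    Finset.sum_nonneg fun _ _ => integral_nonneg fun _ => by positivity
  have hG0 : 0 ≤ Fintype.card ι * (52 * r ^ 2 * η * (s - r)) := by positivity
  rw [sqError, sqError, ← Finset.add_sum_erase _ _ (Finset.mem_univ i₀),
    ← Finset.add_sum_erase _ _ (Finset.mem_univ i₀), h.setIntegral_rescale hr0 hrs]
  nlinarith

/-- The effect of rescaling on the mass, bounded from below. -/
lemma IsCentered.le_mass_rescale [Nontrivial E] (h : T.IsCentered i₀ r₀) {r s η : ℝ}
    (hr : r₀ ≤ r) (hrs : r ≤ s) (hη : 0 < η)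
    (hsmall' : ∀ i ≠ i₀, volume.real (T.piece i r) ≤ η * r) :
    (s / r) ^ finrank ℝ E * (T.mass r - volume.real ((T.U i₀).shell r (r / s * T.w) T.w) -
      Fintype.card ι * (finrank ℝ E * η * (s - r))) ≤ T.mass s := by
  classical
  have hr0 : 0 < r := h.r₀_pos.trans_le hr
  have hs0 : 0 < s := hr0.trans_le hrs
  have hsr : 0 ≤ s - r := by linarith
  set n := finrank ℝ E
  have hp := pow_sub_pow_le hr0.le hs0 n
  have hlp : 0 < (s / r) ^ n := by positivity
  have hoth : ∀ i ∈ Finset.univ.erase i₀,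
      (s / r) ^ n * (volume.real (T.piece i r) - n * η * (s - r)) ≤
        volume.real (T.piece i s) := by
    intro i hi
    refine le_trans ?_ (T.volume_real_piece_mono i hrs)
    set x := volume.real (T.piece i r)
    have hx0 : 0 ≤ x := measureReal_nonneg
    have h1 : x * (s ^ n - r ^ n) ≤ s ^ n * (n * η * (s - r)) := by
      calc x * (s ^ n - r ^ n) ≤ x * (n * s ^ n * ((s - r) / s)) := by gcongr
        _ ≤ (η * r) * (n * s ^ n * ((s - r) / s)) := by
          gcongr; exact hsmall' i (Finset.ne_of_mem_erase hi)
        _ ≤ (η * s) * (n * s ^ n * ((s - r) / s)) := by gcongr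
        _ = s ^ n * (n * η * (s - r)) := by field_simp
    rw [div_pow, div_mul_eq_mul_div, div_le_iff₀ (by positivity)]
    linarith
  have hsum := Finset.sum_le_sum hoth
  rw [← Finset.mul_sum, Finset.sum_sub_distrib, Finset.sum_const, nsmul_eq_mul] at hsum
  have hcard : ((Finset.univ.erase i₀).card : ℝ) * (n * η * (s - r)) ≤
      Fintype.card ι * (n * η * (s - r)) := by
    gcongr
    exact Finset.card_le_univ _
  rw [mass, mass, ← Finset.add_sum_erase _ _ (Finset.mem_univ i₀),
    ← Finset.add_sum_erase _ _ (Finset.mem_univ i₀), h.volume_real_rescale hr0 hrs]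
  nlinarith

end TubeFamily

end Decrease

/-! ### Strict decrease past the first contact -/

section Decrease

variable {ι X Z E : Type*} [Fintype ι] [NormedAddCommGroup X] [InnerProductSpace ℝ X]
  [NormedAddCommGroup Z] [InnerProductSpace ℝ Z] [NormedAddCommGroup E] [InnerProductSpace ℝ E]
  [MeasurableSpace X] [BorelSpace X] [MeasurableSpace Z] [BorelSpace Z]
  [MeasurableSpace E] [BorelSpace E]
  [FiniteDimensional ℝ X] [FiniteDimensional ℝ Z] [FiniteDimensional ℝ E]

namespace TubeFamily

variable {T : TubeFamily ι X Z E} {i₀ : ι} {r₀ : ℝ}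

lemma exists_pos_mul_lt_and_mul_lt {A₁ A₂ a₁ a₂ : ℝ} (hA₁ : 0 ≤ A₁) (hA₂ : 0 ≤ A₂)
    (ha₁ : 0 < a₁) (ha₂ : 0 < a₂) : ∃ η > 0, η * A₁ < a₁ ∧ η * A₂ < a₂ := by
  refine ⟨min (a₁ / (A₁ + 1)) (a₂ / (A₂ + 1)), by positivity, ?_, ?_⟩
  · calc min (a₁ / (A₁ + 1)) (a₂ / (A₂ + 1)) * A₁ ≤ a₁ / (A₁ + 1) * A₁ := by
          gcongr; exact min_le_left _ _
      _ < a₁ := by rw [div_mul_eq_mul_div, div_lt_iff₀ (by positivity)]; nlinarith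
  · calc min (a₁ / (A₁ + 1)) (a₂ / (A₂ + 1)) * A₂ ≤ a₂ / (A₂ + 1) * A₂ := by
          gcongr; exact min_le_right _ _
      _ < a₂ := by rw [div_mul_eq_mul_div, div_lt_iff₀ (by positivity)]; nlinarith

/-- The central flat bounds the least error while the other tubes carry little mass. -/
lemma IsCentered.minError_le_of_small [Nontrivial Z] (h : T.IsCentered i₀ r₀) {r ξ : ℝ}
    (hr : r₀ ≤ r) (hξ : 0 ≤ ξ) (hsmall : ∀ i ≠ i₀, volume.real (T.piece i r) ≤ ξ) :
    T.minError r ≤ (finrank ℝ Z : ℝ) / (finrank ℝ Z + 2) * T.w ^ 2 * T.mass r +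
      Fintype.card ι * (r ^ 2 * ξ) := by
  classical
  have hr0 : 0 < r := h.r₀_pos.trans_le hr
  refine (T.minError_le (T.U i₀) 0 r).trans ?_
  rw [sqError, ← Finset.add_sum_erase _ _ (Finset.mem_univ i₀)]
  simp only [sub_zero]
  refine add_le_add ?_ ?_
  · have h1 := (T.U i₀).setIntegral_norm_nor_sq_slab_le hr0 h.w_pos
    rw [← h.piece_eq] at h1
    refine h1.trans ?_
    gcongr
    exact T.volume_real_piece_le_mass i₀ r
  · have h2 : ∀ i ∈ Finset.univ.erase i₀,
        ∫ v in T.piece i r, ‖(T.U i₀).nor v‖ ^ 2 ≤ r ^ 2 * ξ := by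
      intro i hi
      have h3 := T.setIntegral_piece_le (T.U i₀) 0 i hr0.le
      have h4 : T.piece i 0 = ∅ := by simp [piece]
      simp only [h4, sub_zero, norm_zero, add_zero, Measure.restrict_empty, integral_zero_measure,
        measureReal_empty, zero_add] at h3
      refine h3.trans ?_
      gcongr
      exact hsmall i (Finset.ne_of_mem_erase hi)
    refine (Finset.sum_le_card_nsmul _ _ _ h2).trans ?_
    rw [nsmul_eq_mul]
    gcongr
    exact Finset.card_le_univ _

set_option maxHeartbeats 400000 in
/-- The Jones number keeps decreasing for a while after the first contact with another tube: under
rescaling the central tube loses, to first order, a shell whose mean squared distance to any flat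
is larger than the present mean, while the contribution of the other tubes is of higher order. -/
lemma IsCentered.exists_betaSq_lt [Nontrivial X] [Nontrivial Z] [Nontrivial E]
    (hE : 2 ≤ finrank ℝ E) (h : T.IsCentered i₀ r₀)
    (hthin : (finrank ℝ X + 3) * T.w ^ 2 ≤ r₀ ^ 2) :
    ∃ δ > 0, ∀ r s, r₀ ≤ r → r < s → s ≤ r₀ + δ → T.betaSq s < T.betaSq r := by
  have : Nonempty (Frame X Z E) := ⟨T.U i₀⟩
  have h0 := h.r₀_pos
  have hw := h.w_pos
  have hwr := h.w_lt
  set w := T.w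
  set n := finrank ℝ E
  set k := finrank ℝ Z with hk
  set N := Fintype.card ι
  set V₀ := volume.real (T.piece i₀ r₀)
  have hV₀ : 0 < V₀ := h.volume_real_piece_pos h0
  set R := √(r₀ ^ 2 - w ^ 2) with hR
  have hwr2 : w ^ 2 < r₀ ^ 2 := by gcongr
  have hR2 : R ^ 2 = r₀ ^ 2 - w ^ 2 := Real.sq_sqrt (by linarith)
  have hR0 : 0 < R := Real.sqrt_pos.2 (by linarith)
  set b := volume.real ((T.U i₀).box 0 R w) with hb
  have hb0 : 0 < b := by
    rw [hb, Frame.volume_real_box]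
    exact mul_pos (ENNReal.toReal_pos (measure_ball_pos _ _ hR0).ne' measure_ball_lt_top.ne)
      (ENNReal.toReal_pos (measure_ball_pos _ _ hw).ne' measure_ball_lt_top.ne)
  -- `a₁` leaves room for the other tubes below the threshold `θ w ^ 2` for the mean, with
  -- `θ = (k + 1) / (k + 2)`; `a₂` is the rate at which the central tube gains from rescaling
  set a₁ := w ^ 2 / (k + 2) * V₀ with ha₁
  set a₂ := w ^ 2 / (2 * (k + 2)) * (b / (2 * r₀)) with ha₂
  set A₁ : ℝ := N * (4 * r₀ ^ 3) with hA₁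
  set A₂ : ℝ := N * (208 * r₀ ^ 2) + w ^ 2 * (N * n) with hA₂
  obtain ⟨η, hη, hη₁, hη₂⟩ := exists_pos_mul_lt_and_mul_lt (A₁ := A₁) (A₂ := A₂) (a₁ := a₁)
    (a₂ := a₂) (by positivity) (by positivity) (by positivity) (by positivity)
  obtain ⟨δ, hδ, hcone⟩ := h.exists_forall_volume_piece_sub_le hE hη
  -- the second bound on `s - r₀` keeps `(r / s) ^ 2` above the midpoint of `θ` and `1`
  refine ⟨min δ (r₀ / (4 * (k + 2))), by positivity, fun r s hr hrs hs => ?_⟩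
  have hs1 : s ≤ r₀ + δ := hs.trans (by gcongr; exact min_le_left _ _)
  have hs2 : s ≤ r₀ + r₀ / (4 * (k + 2)) := hs.trans (by gcongr; exact min_le_right _ _)
  have hs3 : s ≤ 2 * r₀ := by
    have : r₀ / (4 * (k + 2)) ≤ r₀ := div_le_self h0.le (by linarith [(Nat.cast_nonneg k : (0 : ℝ) ≤ k)])
    linarith
  have hr0 : 0 < r := h0.trans_le hr
  have hs0 : 0 < s := hr0.trans hrs
  have hx : 0 < s - r := by linarith
  have hsmall : ∀ i ≠ i₀, volume.real (T.piece i s) - volume.real (T.piece i r) ≤ η * (s - r) :=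
    fun i hi => hcone i hi r s hr hrs.le hs1
  have hsmall₁ : ∀ i ≠ i₀, volume.real (T.piece i r) ≤ η * r₀ := by
    intro i hi
    have h1 := hcone i hi r₀ r le_rfl hr (hrs.le.trans hs1)
    rw [h.piece_eq_empty hi le_rfl, measureReal_empty, sub_zero] at h1
    refine h1.trans ?_
    gcongr
    linarith
  have hsmall' : ∀ i ≠ i₀, volume.real (T.piece i r) ≤ η * r :=
    fun i hi => (hsmall₁ i hi).trans (by gcongr)
  have hm : 0 < T.mass r := h.mass_pos hr0
  have hm' : 0 < T.mass s := h.mass_pos hs0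
  have hVm : V₀ ≤ T.mass r :=
    (T.volume_real_piece_mono i₀ hr).trans (T.volume_real_piece_le_mass i₀ r)
  set m := T.mass r
  set m' := T.mass s
  set θ : ℝ := (k + 1) / (k + 2) with hθ
  have hθ1 : 1 - θ = 1 / (k + 2) := by rw [hθ]; field_simp; ring
  have hθle : θ ≤ 1 := by
    have : (0 : ℝ) < 1 / (k + 2) := by positivity
    linarith
  have hmin : T.minError r < θ * w ^ 2 * m := by
    refine (h.minError_le_of_small hr (by positivity) hsmall₁).trans_lt ?_
    have h1 : (N : ℝ) * (r ^ 2 * (η * r₀)) ≤ η * A₁ := by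
      have : r ^ 2 ≤ (2 * r₀) ^ 2 := by gcongr; linarith
      calc (N : ℝ) * (r ^ 2 * (η * r₀)) ≤ N * ((2 * r₀) ^ 2 * (η * r₀)) := by gcongr
        _ = η * A₁ := by rw [hA₁]; ring
    have h2 : a₁ ≤ w ^ 2 / (k + 2) * m := by rw [ha₁]; gcongr
    have h3 : (k : ℝ) / (k + 2) * w ^ 2 * m + w ^ 2 / (k + 2) * m = θ * w ^ 2 * m := by
      rw [hθ]; field_simp
    linarith
  -- a lower bound, uniform in the flat, for the gain from rescaling
  set G := (a₂ - η * A₂) * (s - r) with hG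
  have hG0 : 0 < G := mul_pos (by linarith) hx
  obtain ⟨V, a, hVa⟩ := T.exists_sqError_lt (r := r)
    (t := min (θ * w ^ 2 * m) (T.minError r + G * m / m'))
    (lt_min hmin (lt_add_of_pos_right _ (by positivity)))
  obtain ⟨hVa1, hVa2⟩ := lt_min_iff.1 hVa
  have ha : ‖a‖ ≤ 2 * r := by
    have := T.norm_le_of_sqError_le (V := V) (a := a) hw.le hm (hVa1.le.trans (by
      calc θ * w ^ 2 * m ≤ 1 * w ^ 2 * m := by gcongr
        _ = w ^ 2 * m := by rw [one_mul]))
    linarith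
  have h1 := h.sqError_rescale_le hr hrs.le hs3 hη hsmall hsmall' V ha
  have h2 := h.le_mass_rescale hr hrs.le hη hsmall'
  have hrr : r₀ ^ 2 ≤ r ^ 2 := by gcongr
  have h3 := (T.U i₀).le_setIntegral_shell (w' := r / s * w) (w := w) hr0 (by positivity)
    (by linarith only [hthin, hrr]) V a
  have h4 := (T.U i₀).le_volume_real_shell (R := R) (t := r / s) hr0.le hw
    (by linarith only [hR2, hrr]) (by positivity) ((div_le_one hs0).2 hrs.le)
  set aE := ∫ v in (T.U i₀).shell r (r / s * w) w, ‖V.nor v - a‖ ^ 2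
  set e := volume.real ((T.U i₀).shell r (r / s * w) w)
  set A := T.sqError V a r
  have hA0 : 0 ≤ A := T.sqError_nonneg V a r
  set H := A / m with hH
  have hAH : A = H * m := by rw [hH]; field_simp
  have hH0 : 0 ≤ H := div_nonneg hA0 hm.le
  have hHle : H ≤ θ * w ^ 2 := by rw [hH, div_le_iff₀ hm]; exact hVa1.le
  have he0 : 0 ≤ e := measureReal_nonneg
  -- the shell is far from every flat
  have h5 : w ^ 2 / (2 * (k + 2)) * e ≤ aE - H * e := by
    have h6 : 1 - 2 * ((s - r) / s) ≤ (r / s) ^ 2 := by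
      have h7 : r / s = 1 - (s - r) / s := by field_simp; ring
      have h8 : (1 - (s - r) / s) ^ 2 = 1 - 2 * ((s - r) / s) + ((s - r) / s) ^ 2 := by ring
      rw [h7, h8]
      exact le_add_of_nonneg_right (sq_nonneg _)
    have h7 : (s - r) / s ≤ (1 - θ) / 4 := by
      rw [hθ1, div_le_iff₀ hs0]
      have : r₀ / (4 * (k + 2)) = 1 / (k + 2) / 4 * r₀ := by field_simp
      calc s - r ≤ 1 / (k + 2) / 4 * r₀ := by rw [← this]; linarith only [hs2, hr]
        _ ≤ 1 / (k + 2) / 4 * s := by gcongr; exact hr.trans hrs.le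
    have h8 : (1 - θ) / 2 ≤ (r / s) ^ 2 - θ := by linarith only [h6, h7]
    have h9 : w ^ 2 / (2 * (k + 2)) = (1 - θ) / 2 * w ^ 2 := by rw [hθ1]; field_simp
    rw [mul_pow] at h3
    calc w ^ 2 / (2 * (k + 2)) * e = (1 - θ) / 2 * (w ^ 2 * e) := by rw [h9]; ring
      _ ≤ ((r / s) ^ 2 - θ) * (w ^ 2 * e) := by gcongr
      _ = (r / s) ^ 2 * w ^ 2 * e - θ * w ^ 2 * e := by ring
      _ ≤ aE - H * e := by
        have : H * e ≤ θ * w ^ 2 * e := by gcongr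
        linarith only [this, h3]
  have h6 : a₂ * (s - r) ≤ w ^ 2 / (2 * (k + 2)) * e := by
    have h7 : b / (2 * r₀) * (s - r) ≤ e := by
      refine le_trans ?_ h4
      rw [show 1 - r / s = (s - r) / s by field_simp, div_mul_eq_mul_div, ← mul_div_assoc]
      gcongr
    calc a₂ * (s - r) = w ^ 2 / (2 * (k + 2)) * (b / (2 * r₀) * (s - r)) := by rw [ha₂]; ring
      _ ≤ _ := by gcongr
  have h7 : N * (52 * r ^ 2 * η * (s - r)) + H * (N * (n * η * (s - r))) ≤
      η * A₂ * (s - r) := by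
    have h8 : r ^ 2 ≤ (2 * r₀) ^ 2 := by gcongr; linarith
    have h9 : H ≤ w ^ 2 := hHle.trans (mul_le_of_le_one_left (sq_nonneg w) hθle)
    calc N * (52 * r ^ 2 * η * (s - r)) + H * (N * (n * η * (s - r)))
        ≤ N * (52 * (2 * r₀) ^ 2 * η * (s - r)) + w ^ 2 * (N * (n * η * (s - r))) := by gcongr
      _ = η * A₂ * (s - r) := by rw [hA₂]; ring
  set Q := m - e - N * (n * η * (s - r)) with hQ
  set P := A - aE + N * (52 * r ^ 2 * η * (s - r)) with hP
  have hPQ : P ≤ Q * H - G := by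
    have : Q * H = A - H * e - H * (N * (n * η * (s - r))) := by rw [hQ, hAH]; ring
    rw [this, hP, hG, sub_mul]
    linarith only [h5, h6, h7]
  have hl1 : 1 ≤ (s / r) ^ n := one_le_pow₀ (by rw [le_div_iff₀ hr0]; linarith)
  have hA' : T.minError s ≤ (s / r) ^ 2 * (m' * H - G) := by
    refine (T.minError_le V _ s).trans (h1.trans ?_)
    calc (s / r) ^ (n + 2) * P ≤ (s / r) ^ (n + 2) * (Q * H - G) := by gcongr
      _ = (s / r) ^ 2 * (((s / r) ^ n * Q) * H - (s / r) ^ n * G) := by ring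
      _ ≤ (s / r) ^ 2 * (m' * H - 1 * G) := by gcongr
      _ = _ := by rw [one_mul]
  calc T.betaSq s = T.minError s / (s ^ 2 * m') := rfl
    _ ≤ (s / r) ^ 2 * (m' * H - G) / (s ^ 2 * m') := by gcongr
    _ = (H - G / m') / r ^ 2 := by field_simp
    _ < (T.minError r / m) / r ^ 2 := by
      refine div_lt_div_of_pos_right ?_ (by positivity)
      rw [sub_lt_iff_lt_add, hH, div_lt_iff₀ hm, add_mul, div_mul_cancel₀ _ hm.ne']
      refine hVa2.trans_eq ?_
      ring
    _ = T.betaSq r := by rw [betaSq, div_div, mul_comm m]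

end TubeFamily

end Decrease

/-! ### The first local minimum -/

section Conclusion

variable {ι X Z E : Type*} [Fintype ι] [NormedAddCommGroup X] [InnerProductSpace ℝ X]
  [NormedAddCommGroup Z] [InnerProductSpace ℝ Z] [NormedAddCommGroup E] [InnerProductSpace ℝ E]
  [MeasurableSpace X] [BorelSpace X] [MeasurableSpace Z] [BorelSpace Z]
  [MeasurableSpace E] [BorelSpace E]
  [FiniteDimensional ℝ X] [FiniteDimensional ℝ Z] [FiniteDimensional ℝ E]

/-- A function that decreases strictly up to `r₀` and a little beyond, and has a larger value at
`b` than at `r₀`, has its first local minimum strictly between `r₀` and `b`. -/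
lemma exists_isGLB_isLocalMin {β : ℝ → ℝ} {w r₀ b δ : ℝ} (hδ : 0 < δ) (hrb : r₀ < b)
    (h1 : StrictAntiOn β (Set.Icc w r₀)) (h2 : StrictAntiOn β (Set.Icc r₀ (r₀ + δ)))
    (hw : w ≤ r₀) (hc : ContinuousOn β (Set.Icc r₀ b)) (hb : β r₀ < β b) :
    ∃ s ∈ Set.Ioo r₀ b, IsGLB {r : ℝ | w ≤ r ∧ IsLocalMin β r} s := by
  obtain ⟨t, ht, htmin⟩ := isCompact_Icc.exists_isMinOn (Set.nonempty_Icc.2 hrb.le) hc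
  have htb : t ≠ b := by
    rintro rfl
    exact absurd (htmin (Set.left_mem_Icc.2 hrb.le)) (not_le.2 hb)
  have htr : t ≠ r₀ := by
    rintro rfl
    have hlt : t < min (t + δ) b := lt_min (by linarith) hrb
    have h3 := h2 (Set.left_mem_Icc.2 (by linarith))
      ⟨hlt.le, min_le_left (t + δ) b⟩ hlt
    exact absurd (htmin ⟨hlt.le, min_le_right _ _⟩) (not_le.2 h3)
  have ht1 : r₀ < t := lt_of_le_of_ne ht.1 htr.symm
  have ht2 : t < b := lt_of_le_of_ne ht.2 htb
  have htS : t ∈ {r : ℝ | w ≤ r ∧ IsLocalMin β r} :=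
    ⟨by linarith, htmin.isLocalMin (Icc_mem_nhds ht1 ht2)⟩
  have hright : ∀ {r u : ℝ}, r < u → StrictAntiOn β (Set.Icc r u) → ¬ IsLocalMin β r := by
    intro r u hru hanti hmin
    have h3 : ∀ᶠ x in nhdsWithin r (Set.Ioi r), β r ≤ β x := nhdsWithin_le_nhds hmin
    obtain ⟨x, hx1, hx2⟩ := (h3.and (Ioo_mem_nhdsGT hru)).exists
    exact absurd hx1 (not_le.2 (hanti (Set.left_mem_Icc.2 hru.le) ⟨hx2.1.le, hx2.2.le⟩ hx2.1))
  have hlow : ∀ r ∈ {r : ℝ | w ≤ r ∧ IsLocalMin β r}, r₀ + δ ≤ r := by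
    rintro r ⟨hwr, hmin⟩
    by_contra! hlt
    rcases lt_or_ge r r₀ with hr | hr
    · exact hright hr (h1.mono (Set.Icc_subset_Icc_left hwr)) hmin
    · exact hright hlt (h2.mono (Set.Icc_subset_Icc_left hr)) hmin
  refine ⟨sInf {r : ℝ | w ≤ r ∧ IsLocalMin β r}, ⟨?_, ?_⟩,
    isGLB_csInf ⟨t, htS⟩ ⟨_, hlow⟩⟩
  · exact (show r₀ < r₀ + δ by linarith).trans_le (le_csInf ⟨t, htS⟩ hlow)
  · exact (csInf_le ⟨_, hlow⟩ htS).trans_lt ht2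

namespace TubeFamily

variable {T : TubeFamily ι X Z E} {i₀ : ι} {r₀ : ℝ}

lemma IsCentered.exists_strictAntiOn [Nontrivial X] [Nontrivial Z] [Nontrivial E]
    (hE : 2 ≤ finrank ℝ E) (h : T.IsCentered i₀ r₀)
    (hthin : (finrank ℝ X + 3) * T.w ^ 2 ≤ r₀ ^ 2) :
    ∃ δ > 0, StrictAntiOn T.beta (Set.Icc r₀ (r₀ + δ)) := by
  obtain ⟨δ, hδ, hlt⟩ := h.exists_betaSq_lt hE hthin
  refine ⟨δ, hδ, fun r hr s hs hrs => ?_⟩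
  rw [T.beta_lt_beta_iff (h.r₀_pos.trans_le hs.1) (h.r₀_pos.trans_le hr.1)]
  exact hlt r s hr.1 hrs hs.2

end TubeFamily

end Conclusion

section Distances

variable {D d k K : ℕ} {L : Fin K → AffineSubspace ℝ (EuclideanSpace ℝ (Fin D))}
  {x : EuclideanSpace ℝ (Fin D)} {i₀ : Fin K}
  {T : TubeFamily (Fin K) (EuclideanSpace ℝ (Fin d)) (EuclideanSpace ℝ (Fin k))
      (EuclideanSpace ℝ (Fin D))}

lemma mem_tube_iff (hT : ∀ i v, infDist (x + v) (L i) = ‖(T.U i).nor v - T.c i‖)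
    (i : Fin K) (v : EuclideanSpace ℝ (Fin D)) :
    x + v ∈ tube (L i) T.w ↔ ‖(T.U i).nor v - T.c i‖ < T.w := by
  rw [← hT]; rfl

/-- The distance `r₀` to the tubes gives the distance `r₀ + w` to the flats: otherwise the point of
the tube that divides the segment from the origin to the flat in the ratio `r₀ : w` would be too
close. -/
lemma isCentered_of_infDist (hT : ∀ i v, infDist (x + v) (L i) = ‖(T.U i).nor v - T.c i‖)
    (hx : x ∈ L i₀) (hw : 0 < T.w) (hwr : T.w < distToOtherTubes L T.w i₀ x) :
    T.IsCentered i₀ (distToOtherTubes L T.w i₀ x) where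
  c_eq := by
    have h := hT i₀ 0
    rw [add_zero, infDist_zero_of_mem (show x ∈ (L i₀ : Set _) from hx), map_zero, zero_sub,
      norm_neg] at h
    exact norm_eq_zero.1 h.symm
  w_pos := hw
  w_lt := hwr
  le_norm_c := by
    intro i hi
    set r₀ := distToOtherTubes L T.w i₀ x with hr₀
    have h0 : 0 < r₀ := hw.trans hwr
    by_contra! hlt
    have hsum : 0 < r₀ + T.w := by positivity
    set z := (r₀ / (r₀ + T.w)) • T.c i with hz
    have hq : ‖T.c i‖ / (r₀ + T.w) < 1 := by rwa [div_lt_one hsum]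
    have hz1 : ‖z‖ < r₀ := by
      rw [hz, norm_smul, Real.norm_eq_abs, abs_of_pos (by positivity)]
      calc r₀ / (r₀ + T.w) * ‖T.c i‖ = r₀ * (‖T.c i‖ / (r₀ + T.w)) := by ring
        _ < r₀ := by nlinarith
    have hz2 : ‖z - T.c i‖ < T.w := by
      have : z - T.c i = -((T.w / (r₀ + T.w)) • T.c i) := by
        rw [hz, ← neg_smul, ← sub_eq_zero, sub_sub, ← one_smul ℝ (T.c i), smul_smul, smul_smul,
          ← add_smul, ← sub_smul]
        convert zero_smul ℝ _ using 2
        field_simp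
        ring
      rw [this, norm_neg, norm_smul, Real.norm_eq_abs, abs_of_pos (by positivity)]
      calc T.w / (r₀ + T.w) * ‖T.c i‖ = T.w * (‖T.c i‖ / (r₀ + T.w)) := by ring
        _ < T.w := by nlinarith
    have hmem : x + (T.U i).chart (0, z) ∈ ⋃ i ∈ {i : Fin K | i ≠ i₀}, tube (L i) T.w :=
      Set.mem_biUnion (show i ∈ {i : Fin K | i ≠ i₀} from hi)
        ((mem_tube_iff hT i _).2 (by simpa using hz2))
    have hle : r₀ ≤ dist x (x + (T.U i).chart (0, z)) := infDist_le_dist_of_mem hmem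
    have hnorm : ‖(T.U i).chart (0, z)‖ = ‖z‖ := by
      rw [← sq_eq_sq₀ (norm_nonneg _) (norm_nonneg _), (T.U i).norm_chart_sq]; simp
    rw [dist_self_add_right, hnorm] at hle
    linarith

lemma exists_norm_c_lt (hT : ∀ i v, infDist (x + v) (L i) = ‖(T.U i).nor v - T.c i‖)
    (hK : 2 ≤ K) (hw : 0 < T.w) {η : ℝ} (hη : 0 < η) :
    ∃ j, j ≠ i₀ ∧ ‖T.c j‖ < distToOtherTubes L T.w i₀ x + T.w + η := by
  have : Nontrivial (Fin K) := Fin.nontrivial_iff_two_le.2 hK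
  obtain ⟨i, hi⟩ := exists_ne i₀
  have hne : (⋃ i ∈ {i : Fin K | i ≠ i₀}, tube (L i) T.w).Nonempty :=
    ⟨x + (T.U i).chart (0, T.c i), Set.mem_biUnion (show i ∈ {i : Fin K | i ≠ i₀} from hi)
      ((mem_tube_iff hT i _).2 (by simpa using hw))⟩
  obtain ⟨y, hy, hdist⟩ := (infDist_lt_iff hne).1
    (show infDist x _ < distToOtherTubes L T.w i₀ x + η from lt_add_of_pos_right _ hη)
  simp only [Set.mem_iUnion] at hy
  obtain ⟨j, hj, hyj⟩ := hy
  refine ⟨j, hj, ?_⟩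
  have h1 : ‖(T.U j).nor (y - x) - T.c j‖ < T.w :=
    (mem_tube_iff hT j _).1 (by rwa [add_sub_cancel])
  have h2 := (T.U j).norm_nor_le (y - x)
  rw [dist_comm, dist_eq_norm] at hdist
  have h3 := norm_sub_norm_le (T.c j) ((T.U j).nor (y - x))
  rw [norm_sub_rev] at h3
  linarith

end Distances

theorem theorem1 (D d K : ℕ) (hK : 2 ≤ K) (hd : 1 ≤ d) (hdD : d < D)
    (L : Fin K → AffineSubspace ℝ (EuclideanSpace ℝ (Fin D))) (hL : ∀ i, IsFlat d (L i))
    (w : ℝ) (hw : 0 < w) (i₀ : Fin K) (x₀ : EuclideanSpace ℝ (Fin D)) (hx₀ : x₀ ∈ L i₀)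
    (β : ℝ → ℝ) (hβ : β = fun r => beta2 d (tubesMeasure L w) x₀ r)
    (r₀ : ℝ) (hr₀ : r₀ = distToOtherTubes L w i₀ x₀) (hwr : w < r₀) :
    (∃ c : ℝ, ∀ r ∈ Set.Ioc 0 w, β r = c) ∧
    StrictAntiOn β (Set.Icc w r₀) ∧
    (w / r₀ < widthBound d D K →
      (∃ r ∈ Set.Ioo r₀ (1.09 * r₀), β r₀ < β r) ∧
      (∃ s ∈ Set.Ioo r₀ (1.09 * r₀), IsGLB {r : ℝ | w ≤ r ∧ IsLocalMin β r} s)) := by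
  obtain ⟨k, rfl⟩ := Nat.exists_eq_add_of_le hdD.le
  have hk : 1 ≤ k := by omega
  choose U c hUc using fun i => (hL i).exists_frame rfl x₀
  let T : TubeFamily (Fin K) (EuclideanSpace ℝ (Fin d)) (EuclideanSpace ℝ (Fin k))
    (EuclideanSpace ℝ (Fin (d + k))) := ⟨U, c, w⟩
  have hT : ∀ i v, infDist (x₀ + v) (L i) = ‖(T.U i).nor v - T.c i‖ := hUc
  have : Nonempty (Fin K) := ⟨i₀⟩
  have : Nontrivial (EuclideanSpace ℝ (Fin d)) :=
    nontrivial_of_finrank_pos (R := ℝ) (by rw [finrank_euclideanSpace_fin]; omega)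
  have : Nontrivial (EuclideanSpace ℝ (Fin k)) :=
    nontrivial_of_finrank_pos (R := ℝ) (by rw [finrank_euclideanSpace_fin]; omega)
  have : Nontrivial (EuclideanSpace ℝ (Fin (d + k))) :=
    nontrivial_of_finrank_pos (R := ℝ) (by rw [finrank_euclideanSpace_fin]; omega)
  have hβT : β = T.beta := by
    rw [hβ]
    exact funext fun r => beta2_eq_sqrt_minError (T := T) rfl hT r
  have h : T.IsCentered i₀ r₀ := by
    subst hr₀
    exact isCentered_of_infDist hT hx₀ hw hwr
  have h0 := h.r₀_pos
  rw [hβT]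
  refine ⟨⟨_, fun r hr => h.beta_const hr⟩, h.strictAntiOn_beta, fun hwidth => ?_⟩
  obtain ⟨hw1, hw2, hw3⟩ := le_of_lt_widthBound hd hk hK (div_pos hw h0) hwidth
  have hlt : T.beta r₀ < T.beta (1.0899 * r₀) := by
    rw [T.beta_lt_beta_iff h0 (by positivity)]
    refine h.betaSq_lt (fun η hη => ?_) (by rwa [Fintype.card_fin]) hw1 ?_
    · rw [hr₀]
      exact exists_norm_c_lt hT hK hw hη
    · rwa [finrank_euclideanSpace_fin, finrank_euclideanSpace_fin, Fintype.card_fin]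
  obtain ⟨δ, hδ, hanti⟩ := h.exists_strictAntiOn
    (by rw [finrank_euclideanSpace_fin]; omega) (by
      rw [finrank_euclideanSpace_fin]
      rw [div_pow, mul_div_assoc', div_le_one (by positivity)] at hw3
      exact hw3)
  refine ⟨⟨1.0899 * r₀, ⟨by linarith, by linarith⟩, hlt⟩, ?_⟩
  obtain ⟨s, hs, hglb⟩ := exists_isGLB_isLocalMin hδ (show r₀ < 1.0899 * r₀ by linarith)
    h.strictAntiOn_beta hanti hwr.le
    (fun r hr => (h.continuousAt_beta (h0.trans_le hr.1)).continuousWithinAt) hlt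
  exact ⟨s, ⟨hs.1, hs.2.trans (by linarith)⟩, hglb⟩
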